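/- Let $(M,J)$ be a smooth almost complex manifold of complex dimension $n>1$, equipped with a smooth Hermitian metric (a Riemannian metric for which $J$ is an isometry). Let $\rho_1,\dots,\rho_n:M\to\mathbb R$ be smooth functions, let $E=\{\rho_1=\dots=\rho_n=0\}$, and suppose that $\overline\partial_J\rho_1\wedge\dots\wedge\overline\partial_J\rho_n\neq0$ near $E$ (so that $E$ is a totally real submanifold of dimension $n$). Here $\overline\partial_JF=\tfrac12(dF+i\,dF\circ J)$ denotes the $(0,1)$-part of the differential. Let $W(E)=\{\rho_1<0,\dots,\rho_n<0\}$ be the corresponding wedge with edge $E$. Let $F:W(E)\to\mathbb C$ be a bounded function of class $C^1$ such that $\overline\partial_JF$ is bounded on $W(E)$ (with respect to the metric). Let $p\in E$, and let $\gamma_1:[0,1]\to M$ be a $p$-admissible curve: $\gamma_1$ is of class $C^\infty$ on $[0,1]$, $\gamma_1(t)\in W(E)$ for $0\le t<1$, $\gamma_1(1)=p$, and $\gamma_1$ is not tangent at $p$ to any face $\{\rho_j=0\}$, that is, $d\rho_j(\gamma_1'(1))\ne0$ for $j=1,\dots,n$. Suppose that $F(\gamma_1(t))\to L\in\mathbb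 C$ as $t\to1^-$. Then $F(\gamma_2(t))\to L$ as $t\to1^-$ for every continuous curve $\gamma_2:[0,1[\,\to W(E)$ that tends to $p$ as $t\to1^-$ and is tangent to $\gamma_1$ at $p$, i.e. such that in local coordinates near $p$ one has $\gamma_2(t)=p+c(t)\gamma_1'(1)+o(c(t))$ as $t\to1^-$ for some real function $c$. -/

import Mathlib

open Set Filter Topology Manifold Bundle Asymptotics
open scoped ContDiff

noncomputable section

/-- A smooth almost complex structure on a smooth manifold `M` of real dimension `m`: a smooth
section `J` of the bundle of endomorphisms of the tangent bundle with `J(p)² = -Id`. -/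
structure AlmostComplexStructure (m : ℕ) (M : Type*) [TopologicalSpace M]
    [ChartedSpace (EuclideanSpace ℝ (Fin m)) M] [IsManifold (𝓡 m) ∞ M] where
  /-- the endomorphism `J(p)` of the tangent space `T_p M` -/
  J : ∀ p : M, TangentSpace (𝓡 m) p →L[ℝ] TangentSpace (𝓡 m) p
  J_sq : ∀ (p : M) (v : TangentSpace (𝓡 m) p), J p (J p v) = -v
  smooth : ContMDiff (𝓡 m)
    ((𝓡 m).prod 𝓘(ℝ, EuclideanSpace ℝ (Fin m) →L[ℝ] EuclideanSpace ℝ (Fin m))) ∞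
    (fun p : M => TotalSpace.mk' (EuclideanSpace ℝ (Fin m) →L[ℝ] EuclideanSpace ℝ (Fin m))
      (E := fun p : M => TangentSpace (𝓡 m) p →L[ℝ] TangentSpace (𝓡 m) p) p (J p))

/-- A smooth Riemannian metric on the manifold `M`. -/
abbrev SmoothMetric (m : ℕ) (M : Type*) [TopologicalSpace M]
    [ChartedSpace (EuclideanSpace ℝ (Fin m)) M] [IsManifold (𝓡 m) ∞ M] :=
  ContMDiffRiemannianMetric (𝓡 m) ∞ (EuclideanSpace ℝ (Fin m))
    (fun p : M => TangentSpace (𝓡 m) p)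

section

variable {m : ℕ} {M : Type*} [TopologicalSpace M]
  [ChartedSpace (EuclideanSpace ℝ (Fin m)) M] [IsManifold (𝓡 m) ∞ M]

/-- The metric `g` is Hermitian with respect to `J`, i.e. `J(p)` is an isometry of `T_p M`. -/
def SmoothMetric.IsHermitian (g : SmoothMetric m M) (𝒥 : AlmostComplexStructure m M) : Prop :=
  ∀ (p : M) (v w : TangentSpace (𝓡 m) p), g.inner p (𝒥.J p v) (𝒥.J p w) = g.inner p v w

/-- The differential at `p` of a complex function, as an `ℝ`-linear form with values in `ℂ`. -/
def complexDifferential (m : ℕ) {M : Type*} [TopologicalSpace M]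
    [ChartedSpace (EuclideanSpace ℝ (Fin m)) M] (F : M → ℂ) (p : M) :
    TangentSpace (𝓡 m) p →L[ℝ] ℂ :=
  mfderiv (𝓡 m) 𝓘(ℝ, ℂ) F p

/-- `∂̄_J F` at `p`: the `(0,1)`-part `(dF + i dF ∘ J) / 2` of the differential of `F`. -/
def AlmostComplexStructure.dbar (𝒥 : AlmostComplexStructure m M) (F : M → ℂ) (p : M) :
    TangentSpace (𝓡 m) p →L[ℝ] ℂ :=
  (1 / 2 : ℂ) • (complexDifferential m F p +
    Complex.I • (complexDifferential m F p).comp (𝒥.J p))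

/-- The edge `E = {ρ₁ = ⋯ = ρ_k = 0}`. -/
def edge {k : ℕ} (ρ : Fin k → M → ℝ) : Set M := {p | ∀ j, ρ j p = 0}

/-- The wedge `W(E) = {ρ₁ < 0, …, ρ_k < 0}`. -/
def wedge {k : ℕ} (ρ : Fin k → M → ℝ) : Set M := {p | ∀ j, ρ j p < 0}

/-- `ρ₁, …, ρ_k` are smooth functions on `M` with `∂̄_J ρ₁ ∧ ⋯ ∧ ∂̄_J ρ_k ≠ 0` near the edge.
The edge is then a generic submanifold of real codimension `k`; it is totally real when `k` is
the complex dimension of `M`. -/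
structure IsGenericDefiningFamily (𝒥 : AlmostComplexStructure m M) {k : ℕ}
    (ρ : Fin k → M → ℝ) : Prop where
  smooth : ∀ j, ContMDiff (𝓡 m) 𝓘(ℝ, ℝ) ∞ (ρ j)
  generic : ∀ᶠ p in 𝓝ˢ (edge ρ),
    ExteriorAlgebra.ιMulti ℂ k (M := TangentSpace (𝓡 m) p →L[ℝ] ℂ)
      (fun j => 𝒥.dbar (fun q => (ρ j q : ℂ)) p) ≠ 0

/-- `F` is a bounded function of class `C¹` on `W` such that `∂̄_J F` is bounded on `W`, where
covectors are measured with the metric `g`. -/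
structure IsBoundedDbarSubsolution (𝒥 : AlmostComplexStructure m M) (g : SmoothMetric m M)
    (W : Set M) (F : M → ℂ) : Prop where
  contMDiffOn : ContMDiffOn (𝓡 m) 𝓘(ℝ, ℂ) 1 F W
  bounded : ∃ C : ℝ, ∀ p ∈ W, ‖F p‖ ≤ C
  dbar_bounded : ∃ C : ℝ, ∀ p ∈ W, ∀ v : TangentSpace (𝓡 m) p,
    ‖𝒥.dbar F p v‖ ≤ C * Real.sqrt (g.inner p v v)

/-- The velocity `γ'(1) ∈ T_{γ(1)} M` of a curve `γ` defined on `[0,1]`. -/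
def endVelocity (m : ℕ) {M : Type*} [TopologicalSpace M]
    [ChartedSpace (EuclideanSpace ℝ (Fin m)) M] (γ : ℝ → M) : TangentSpace (𝓡 m) (γ 1) :=
  mfderivWithin 𝓘(ℝ, ℝ) (𝓡 m) γ (Icc 0 1) 1 (1 : ℝ)

/-- `γ` is a `p`-admissible curve in the wedge: it is smooth on `[0,1]`, lies in the wedge for
`t < 1`, ends at the point `p` of the edge, and is not tangent there to any of the faces
`{ρ_j = 0}`, i.e. `dρ_j (γ'(1)) ≠ 0`. -/
structure IsAdmissibleCurve {k : ℕ} (ρ : Fin k → M → ℝ) (p : M) (γ : ℝ → M) : Prop where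
  smooth : ContMDiffOn 𝓘(ℝ, ℝ) (𝓡 m) ∞ γ (Icc 0 1)
  mem_wedge : ∀ t ∈ Ico (0 : ℝ) 1, γ t ∈ wedge ρ
  end_eq : γ 1 = p
  mem_edge : p ∈ edge ρ
  not_tangent : ∀ j, mfderiv (𝓡 m) 𝓘(ℝ, ℝ) (ρ j) (γ 1) (endVelocity m γ) ≠ (0 : ℝ)

/-- A curve `γ : [0,1[ → M` converges to `p` as `t → 1` and has at `p` the tangent line spanned by
the (nonzero) vector `v ∈ T_p M`: in a chart around `p`, `γ(t) = p + c(t) v + o(c(t))` with a real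
function `c`. For a curve with nonzero velocity at `t = 1`, this says that the
velocity is a multiple of `v`; it does not depend on the parametrization of `γ`. -/
def HasTangentLineAtEnd (γ : ℝ → M) (p : M) (v : TangentSpace (𝓡 m) p) : Prop :=
  Tendsto γ (𝓝[<] 1) (𝓝 p) ∧
  ∃ c : ℝ → ℝ,
    (fun t => extChartAt (𝓡 m) p (γ t) - extChartAt (𝓡 m) p p -
      c t • (show EuclideanSpace ℝ (Fin m) from
        mfderiv (𝓡 m) 𝓘(ℝ, EuclideanSpace ℝ (Fin m)) (extChartAt (𝓡 m) p) p v))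
      =o[𝓝[<] 1] c

end

end

/-!
The theorem is an interior estimate. In a chart around `p` write `G` for `F` and let `v` be the
velocity of `γ₁` at `p`. The curve `γ₁` comes from the wedge, so all `dρ_j(v)` are positive, and
`γ₂` in the wedge forces `c(t) < 0` near `t = 1` and `c(t) → 0`. The points `a = γ₁(1 + c(t))` and
`b = γ₂(t)` then satisfy `a - b = o(c(t))`, while balls of radius `r = ε |c(t)|` around both stay in
the wedge. It remains to see that `G(a) - G(b) → 0` for such points (`tendsto_sub_of_dbar_bounded`).

For this, compare `G(a)` with the mean of `G(a + r x)` against the bump function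
`φ_a(x) = ψ(‖x‖² + ‖J(a) x‖²)`. The derivative of this mean in `r` is `∫ φ_a(x) dG_{a + r x}(x) dx`.
Up to `∂̄_J G`, which is bounded, one may replace `dG(x)` by `-i dG(J(a + r x) x)`, and then integrate
by parts: the result is `1 / r` times the integral of `G` against the divergence of the field
`φ_a(x) J(a + r x) x`. For the frozen structure `J(a)` this divergence vanishes, because `J(a)` has
trace zero and `φ_a` is constant along `x ↦ J(a) x` to first order; since `J` is `C¹` and has trace
zero everywhere, it is `O(r)`. Thus the derivative is bounded by the bounds of `G` and `∂̄_J G` alone,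
and `G(a)` differs from its mean by `O(r)` (`norm_integral_smul_sub_le`), with no control on `dG`.
The means at `a` and `b` have kernels that differ by `o(1)` in `L¹` since `a - b = o(r)`, so `G(a)`
and `G(b)` have the same limit.
-/

open MeasureTheory

/-! ### Traces -/

/-- A real matrix `J` with `J² = -1` is skew for the inner product with Gram matrix
`P = 1 + JᵀJ`, so it is conjugate to `-Jᵀ` and its trace vanishes. -/
theorem Matrix.trace_eq_zero_of_mul_self_eq_neg_one {ι : Type*} [Fintype ι] [DecidableEq ι]
    {J : Matrix ι ι ℝ} (hJ : J * J = -1) : J.trace = 0 := by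
  set P : Matrix ι ι ℝ := 1 + J.transpose * J with hP
  have hPd : P.PosDef := by
    have := Matrix.posSemidef_conjTranspose_mul_self J
    rw [Matrix.conjTranspose_eq_transpose_of_trivial] at this
    exact Matrix.PosDef.one.add_posSemidef this
  have hu : IsUnit P.det := (Matrix.isUnit_iff_isUnit_det P).1 hPd.isUnit
  have hJT : J.transpose * J.transpose = -1 := by
    rw [← Matrix.transpose_mul, hJ]; simp
  have h1 : P * J = -(J.transpose * P) := by
    rw [hP, add_mul, mul_add, mul_assoc, hJ, ← mul_assoc, hJT]
    simp
  have h2 : J.trace = -J.trace := by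
    calc J.trace = (P⁻¹ * (P * J)).trace := by
          rw [← mul_assoc, Matrix.nonsing_inv_mul _ hu, one_mul]
      _ = -(P⁻¹ * (J.transpose * P)).trace := by rw [h1]; simp
      _ = -J.trace := by
          rw [Matrix.trace_mul_comm, mul_assoc, Matrix.mul_nonsing_inv _ hu, mul_one,
            Matrix.trace_transpose]
  linarith

section
variable {E : Type*} [NormedAddCommGroup E] [InnerProductSpace ℝ E] [FiniteDimensional ℝ E]

theorem ContinuousLinearMap.trace_eq_zero_of_sq_eq_neg {T : E →L[ℝ] E}
    (hT : ∀ v, T (T v) = -v) : LinearMap.trace ℝ E (T : E →ₗ[ℝ] E) = 0 := by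
  let b := Module.finBasis ℝ E
  rw [LinearMap.trace_eq_matrix_trace ℝ b]
  apply Matrix.trace_eq_zero_of_mul_self_eq_neg_one
  rw [← LinearMap.toMatrix_mul]
  have : (T : E →ₗ[ℝ] E) * (T : E →ₗ[ℝ] E) = -1 := by ext v; simp [hT]
  rw [this]; simp

theorem ContinuousLinearMap.abs_trace_le (T : E →L[ℝ] E) :
    |LinearMap.trace ℝ E (T : E →ₗ[ℝ] E)| ≤ Module.finrank ℝ E * ‖T‖ := by
  rw [LinearMap.trace_eq_sum_inner _ (stdOrthonormalBasis ℝ E)]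
  refine (Finset.abs_sum_le_sum_abs _ _).trans ?_
  calc _ ≤ ∑ _i : Fin (Module.finrank ℝ E), ‖T‖ := by
        refine Finset.sum_le_sum fun i _ => ?_
        refine (abs_real_inner_le_norm _ _).trans ?_
        have := T.le_opNorm (stdOrthonormalBasis ℝ E i)
        simpa using this
    _ = _ := by simp

/-! ### Integration by parts -/

variable [MeasurableSpace E] [BorelSpace E]

/-- Integration by parts along a compactly supported vector field; the divergence of `V` is the
trace of its derivative. -/
theorem integral_fderiv_apply_eq_neg_trace {H : E → ℂ} {V : E → E} (hH : ContDiff ℝ 1 H)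
    (hV : ContDiff ℝ 1 V) (hVc : HasCompactSupport V) :
    ∫ x, fderiv ℝ H x (V x) =
      -∫ x, LinearMap.trace ℝ E (fderiv ℝ V x : E →ₗ[ℝ] E) • H x := by
  let e := stdOrthonormalBasis ℝ E
  have hH1 : Continuous (fderiv ℝ H) := hH.continuous_fderiv one_ne_zero
  have hV1 : Continuous (fderiv ℝ V) := hV.continuous_fderiv one_ne_zero
  have hH0 := hH.continuous
  have hV0 := hV.continuous
  have hVc' : HasCompactSupport (fderiv ℝ V) := hVc.fderiv ℝ
  -- the components of `V`
  let w : Fin (Module.finrank ℝ E) → E → ℝ := fun i x => inner ℝ (e i) (V x)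
  have hw : ∀ i, ContDiff ℝ 1 (w i) := fun i => contDiff_const.inner ℝ hV
  have hwc : ∀ i, HasCompactSupport (w i) := fun i =>
    hVc.comp_left (g := fun y => inner ℝ (e i) y) (by simp)
  have hw' : ∀ i x v, fderiv ℝ (w i) x v = inner ℝ (e i) (fderiv ℝ V x v) := by
    intro i x v
    have := ((hV.differentiable one_ne_zero x).hasFDerivAt)
    have h2 := ((innerSL ℝ (e i)).hasFDerivAt (x := V x)).comp x this
    rw [show w i = (innerSL ℝ (e i)) ∘ V from rfl, h2.fderiv]
    simp
  have hwi : ∀ i, Continuous (fderiv ℝ (w i)) := fun i => (hw i).continuous_fderiv one_ne_zero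
  have hwci : ∀ i, HasCompactSupport (fderiv ℝ (w i)) := fun i => (hwc i).fderiv ℝ
  have I1 : ∀ i, Integrable (fun x => w i x • fderiv ℝ H x (e i)) := fun i => by
    refine Continuous.integrable_of_hasCompactSupport ?_ ((hwc i).smul_right)
    exact (hw i).continuous.smul (hH1.clm_apply continuous_const)
  have I2 : ∀ i, Integrable (fun x => fderiv ℝ (w i) x (e i) • H x) := fun i => by
    refine Continuous.integrable_of_hasCompactSupport ?_ ?_
    · exact ((hwi i).clm_apply continuous_const).smul hH0
    · exact ((hwci i).comp_left (g := fun T : E →L[ℝ] ℝ => T (e i)) (by simp)).smul_right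
  have I3 : ∀ i, Integrable (fun x => w i x • H x) := fun i => by
    refine Continuous.integrable_of_hasCompactSupport ?_ ((hwc i).smul_right)
    exact (hw i).continuous.smul hH0
  have h1 : ∀ x, fderiv ℝ H x (V x) = ∑ i, w i x • fderiv ℝ H x (e i) := by
    intro x
    conv_lhs => rw [← e.sum_repr' (V x)]
    simp [w]
  have h2 : ∀ x, LinearMap.trace ℝ E (fderiv ℝ V x : E →ₗ[ℝ] E) • H x =
      ∑ i, fderiv ℝ (w i) x (e i) • H x := by
    intro x
    rw [LinearMap.trace_eq_sum_inner _ e, Finset.sum_smul]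
    simp [hw']
  simp_rw [h1, h2]
  rw [integral_finsetSum _ fun i _ => I1 i, integral_finsetSum _ fun i _ => I2 i,
    ← Finset.sum_neg_distrib]
  refine Finset.sum_congr rfl fun i _ => ?_
  exact integral_smul_fderiv_eq_neg_fderiv_smul_of_integrable (I2 i) (I1 i) (I3 i)
    (fun x _ => (hw i).differentiable one_ne_zero x)
    (fun x _ => hH.differentiable one_ne_zero x)

end

section
variable {E : Type*} [NormedAddCommGroup E] [InnerProductSpace ℝ E] [FiniteDimensional ℝ E]

/-! ### The mollification estimate -/

/-- If `J² = -1` near `a + τ x` and the bump function `φ` is constant to first order along the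
linear field `J(a) x`, then the field `φ(x) J(a + τ x) x` has divergence `O(τ)`. -/
theorem abs_trace_fderiv_smul_apply_le {J : E → E →L[ℝ] E} {φ : E → ℝ} {a : E} {A K τ r : ℝ}
    (hJ : ContDiff ℝ 1 J) (hφ : ContDiff ℝ 1 φ) (hτ : 0 < τ) (hτr : τ ≤ r)
    (hJsq : ∀ x ∈ Metric.ball a r, ∀ v, J x (J x v) = -v)
    (hJK : ∀ x ∈ Metric.ball a r, ‖fderiv ℝ J x‖ ≤ K)
    (hφA : ∀ x, |φ x| ≤ A) (hφA' : ∀ x, ‖fderiv ℝ φ x‖ ≤ A)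
    (hφJ : ∀ x, fderiv ℝ φ x (J a x) = 0) {x : E} (hx : x ∈ Metric.ball (0 : E) 1) :
    |LinearMap.trace ℝ E (fderiv ℝ (fun x => φ x • J (a + τ • x) x) x : E →ₗ[ℝ] E)| ≤
      A * K * (1 + Module.finrank ℝ E) * τ := by
  have hx1 : ‖x‖ < 1 := by simpa using hx
  have hA : 0 ≤ A := (abs_nonneg _).trans (hφA 0)
  have hmem : a + τ • x ∈ Metric.ball a r := by
    rw [Metric.mem_ball, dist_eq_norm, add_sub_cancel_left, norm_smul, Real.norm_of_nonneg hτ.le]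
    nlinarith [norm_nonneg x]
  have har : a ∈ Metric.ball a r := Metric.mem_ball_self (hτ.trans_le hτr)
  have hK : 0 ≤ K := le_trans (norm_nonneg (fderiv ℝ J a)) (hJK a har)
  have hM : HasFDerivAt (fun x => J (a + τ • x)) (τ • fderiv ℝ J (a + τ • x)) x := by
    have h1 : HasFDerivAt (fun x : E => a + τ • x) (τ • ContinuousLinearMap.id ℝ E) x :=
      ((hasFDerivAt_id x).const_smul τ).const_add a
    have h2 := (hJ.differentiable one_ne_zero (a + τ • x)).hasFDerivAt.comp x h1
    have h3 : fderiv ℝ J (a + τ • x) ∘L (τ • ContinuousLinearMap.id ℝ E) =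
        τ • fderiv ℝ J (a + τ • x) := by ext; simp
    rw [h3] at h2
    exact h2
  have hφ' := (hφ.differentiable one_ne_zero x).hasFDerivAt
  have hV := hφ'.smul (hM.clm_apply (hasFDerivAt_id x))
  set D : E →L[ℝ] E := (fderiv ℝ J (a + τ • x)).flip x with hD
  have hVeq : (fderiv ℝ (fun x => φ x • J (a + τ • x) x) x : E →ₗ[ℝ] E) =
      φ x • ((J (a + τ • x) : E →ₗ[ℝ] E) + τ • (D : E →ₗ[ℝ] E)) +
        (fderiv ℝ φ x : E →ₗ[ℝ] ℝ).smulRight (J (a + τ • x) x) := by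
    have h1 : fderiv ℝ (fun x => φ x • J (a + τ • x) x) x = _ := hV.fderiv
    rw [h1]
    ext v; simp [hD]
  rw [hVeq, map_add, map_smul, map_add, map_smul,
    ContinuousLinearMap.trace_eq_zero_of_sq_eq_neg (hJsq _ hmem), LinearMap.trace_smulRight,
    zero_add, smul_eq_mul, smul_eq_mul]
  have hDn : ‖D‖ ≤ K := by
    refine ContinuousLinearMap.opNorm_le_bound _ hK fun v => ?_
    calc ‖D v‖ = ‖fderiv ℝ J (a + τ • x) v x‖ := rfl
      _ ≤ ‖fderiv ℝ J (a + τ • x)‖ * ‖v‖ * ‖x‖ := ContinuousLinearMap.le_opNorm₂ _ _ _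
      _ ≤ K * ‖v‖ * 1 := by gcongr; exact hJK _ hmem
      _ = K * ‖v‖ := mul_one _
  have hdiff : ‖J (a + τ • x) - J a‖ ≤ K * τ := by
    have := (convex_ball a r).norm_image_sub_le_of_norm_fderiv_le (𝕜 := ℝ) (f := J) (C := K)
      (fun y _ => hJ.differentiable one_ne_zero y) hJK har hmem
    refine this.trans ?_
    rw [add_sub_cancel_left, norm_smul, Real.norm_of_nonneg hτ.le]
    have : τ * ‖x‖ ≤ τ := by nlinarith
    gcongr
  have h2 : |fderiv ℝ φ x (J (a + τ • x) x)| ≤ A * (K * τ) := by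
    have h3 : fderiv ℝ φ x (J (a + τ • x) x) = fderiv ℝ φ x ((J (a + τ • x) - J a) x) := by
      simp [hφJ]
    rw [h3, ← Real.norm_eq_abs]
    calc _ ≤ ‖fderiv ℝ φ x‖ * (‖J (a + τ • x) - J a‖ * ‖x‖) :=
          (ContinuousLinearMap.le_opNorm _ _).trans (by gcongr; exact ContinuousLinearMap.le_opNorm _ _)
      _ ≤ A * (K * τ * 1) := by gcongr; exact hφA' x
      _ = _ := by ring
  have h1 : |φ x * (τ * LinearMap.trace ℝ E (D : E →ₗ[ℝ] E))| ≤
      A * (τ * (Module.finrank ℝ E * K)) := by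
    rw [abs_mul, abs_mul, abs_of_pos hτ]
    gcongr
    · exact hφA x
    · exact D.abs_trace_le.trans (by gcongr)
  calc _ ≤ A * (τ * (Module.finrank ℝ E * K)) + A * (K * τ) := (abs_add_le _ _).trans (add_le_add h1 h2)
    _ = _ := by ring

variable [MeasurableSpace E] [BorelSpace E]

theorem norm_integral_le_of_eq_zero_off_ball {f : E → ℂ} {C : ℝ}
    (h0 : ∀ x ∉ Metric.ball (0 : E) 1, f x = 0) (hC : ∀ x ∈ Metric.ball (0 : E) 1, ‖f x‖ ≤ C) :
    ‖∫ x, f x‖ ≤ C * volume.real (Metric.ball (0 : E) 1) := by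
  rw [← setIntegral_eq_integral_of_forall_compl_eq_zero h0]
  exact norm_setIntegral_le_of_norm_le_const measure_ball_lt_top hC

/-- The mean of the radial derivative of `G` against a `J(a)`-invariant bump function is bounded
in terms of the bounds of `G` and `∂̄_J G` only: up to `∂̄_J G`, the radial derivative is the
derivative along `J(a + τ x) x`, and an integration by parts moves that derivative onto the bump
function, at the cost of a divergence of size `O(τ)` divided by `τ`. -/
theorem norm_integral_smul_fderiv_apply_le {J : E → E →L[ℝ] E} {φ : E → ℝ} {G : E → ℂ} {a : E}
    {A C K τ r : ℝ}
    (hG : ContDiff ℝ 1 G) (hJ : ContDiff ℝ 1 J) (hφ : ContDiff ℝ 1 φ) (hτ : 0 < τ) (hτr : τ ≤ r)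
    (hJsq : ∀ x ∈ Metric.ball a r, ∀ v, J x (J x v) = -v)
    (hJK : ∀ x ∈ Metric.ball a r, ‖fderiv ℝ J x‖ ≤ K)
    (hGC : ∀ x ∈ Metric.ball a r, ‖G x‖ ≤ C)
    (hdG : ∀ x ∈ Metric.ball a r, ∀ v,
      ‖fderiv ℝ G x v + Complex.I * fderiv ℝ G x (J x v)‖ ≤ C * ‖v‖)
    (hφA : ∀ x, |φ x| ≤ A) (hφA' : ∀ x, ‖fderiv ℝ φ x‖ ≤ A)
    (hφs : tsupport φ ⊆ Metric.ball 0 1)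
    (hφJ : ∀ x, fderiv ℝ φ x (J a x) = 0) :
    ‖∫ x, φ x • fderiv ℝ G (a + τ • x) x‖ ≤
      A * C * (1 + K * (1 + Module.finrank ℝ E)) * volume.real (Metric.ball (0 : E) 1) := by
  have hA : 0 ≤ A := (abs_nonneg _).trans (hφA 0)
  have hφc : HasCompactSupport φ := by
    refine HasCompactSupport.of_support_subset_isCompact (isCompact_closedBall (0 : E) 1) ?_
    exact (subset_tsupport φ).trans (hφs.trans Metric.ball_subset_closedBall)
  have hmem : ∀ x ∈ Metric.ball (0 : E) 1, a + τ • x ∈ Metric.ball a r := by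
    intro x hx
    have hx1 : ‖x‖ < 1 := by simpa using hx
    rw [Metric.mem_ball, dist_eq_norm, add_sub_cancel_left, norm_smul, Real.norm_of_nonneg hτ.le]
    nlinarith [norm_nonneg x]
  have har : a ∈ Metric.ball a r := Metric.mem_ball_self (hτ.trans_le hτr)
  have hC : 0 ≤ C := (norm_nonneg _).trans (hGC a har)
  have hK : 0 ≤ K := le_trans (norm_nonneg (fderiv ℝ J a)) (hJK a har)
  have hG1 : Continuous (fderiv ℝ G) := hG.continuous_fderiv one_ne_zero
  have hJ0 := hJ.continuous
  have hφ0 := hφ.continuous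
  have haff : Continuous fun x : E => a + τ • x := by fun_prop
  have hJa : Continuous fun x : E => J (a + τ • x) x := (hJ0.comp haff).clm_apply continuous_id
  have hzero : ∀ x ∉ Metric.ball (0 : E) 1, φ x = 0 := fun x hx =>
    image_eq_zero_of_notMem_tsupport fun h => hx (hφs h)
  -- the two pieces of the radial derivative
  set f₁ : E → ℂ := fun x => φ x • (fderiv ℝ G (a + τ • x) x +
    Complex.I * fderiv ℝ G (a + τ • x) (J (a + τ • x) x)) with hf₁
  set f₂ : E → ℂ := fun x => φ x • fderiv ℝ G (a + τ • x) (J (a + τ • x) x) with hf₂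
  have hc₁ : Continuous fun x => fderiv ℝ G (a + τ • x) x := (hG1.comp haff).clm_apply continuous_id
  have hc₂ : Continuous fun x => fderiv ℝ G (a + τ • x) (J (a + τ • x) x) :=
    (hG1.comp haff).clm_apply hJa
  have hi₁ : Integrable f₁ := Continuous.integrable_of_hasCompactSupport
    (hφ0.smul (hc₁.add (continuous_const.mul hc₂))) hφc.smul_right
  have hi₂ : Integrable f₂ := Continuous.integrable_of_hasCompactSupport
    (hφ0.smul hc₂) hφc.smul_right
  have hsplit : ∫ x, φ x • fderiv ℝ G (a + τ • x) x = (∫ x, f₁ x) - Complex.I * ∫ x, f₂ x := by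
    rw [← integral_const_mul, ← integral_sub hi₁ (hi₂.const_mul _)]
    refine integral_congr_ae (Eventually.of_forall fun x => ?_)
    simp only [hf₁, hf₂, Complex.real_smul]
    ring
  have hb₁ : ‖∫ x, f₁ x‖ ≤ A * C * volume.real (Metric.ball (0 : E) 1) := by
    refine norm_integral_le_of_eq_zero_off_ball (fun x hx => by simp [hf₁, hzero x hx]) ?_
    intro x hx
    have hx1 : ‖x‖ < 1 := by simpa using hx
    rw [hf₁, norm_smul, Real.norm_eq_abs]
    calc _ ≤ A * (C * ‖x‖) := by
          gcongr
          · exact hφA x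
          · exact hdG _ (hmem x hx) x
      _ ≤ A * (C * 1) := by gcongr
      _ = A * C := by ring
  -- integration by parts for the second piece
  set V : E → E := fun x => φ x • J (a + τ • x) x with hVdef
  have hV : ContDiff ℝ 1 V := by
    have h1 : ContDiff ℝ 1 fun x : E => a + τ • x := by fun_prop
    exact hφ.smul ((hJ.comp h1).clm_apply contDiff_id)
  have hVsupp : tsupport V ⊆ Metric.ball 0 1 := (tsupport_smul_subset_left _ _).trans hφs
  have hVc : HasCompactSupport V := hφc.smul_right
  have hGτ : ContDiff ℝ 1 fun x => G (a + τ • x) := hG.comp (by fun_prop)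
  have hdGτ : ∀ x v, fderiv ℝ (fun x => G (a + τ • x)) x v = τ • fderiv ℝ G (a + τ • x) v := by
    intro x v
    have h1 : HasFDerivAt (fun x : E => a + τ • x) (τ • ContinuousLinearMap.id ℝ E) x :=
      ((hasFDerivAt_id x).const_smul τ).const_add a
    have h2 := (hG.differentiable one_ne_zero (a + τ • x)).hasFDerivAt.comp x h1
    have h3 : fderiv ℝ (fun x => G (a + τ • x)) x = _ := h2.fderiv
    rw [h3]; simp
  have hibp := integral_fderiv_apply_eq_neg_trace hGτ hV hVc
  have hleft : ∫ x, fderiv ℝ (fun x => G (a + τ • x)) x (V x) = τ • ∫ x, f₂ x := by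
    rw [← integral_smul]
    refine integral_congr_ae (Eventually.of_forall fun x => ?_)
    simp only [hdGτ, hf₂, hVdef, map_smul]
  have hb₂ : ‖∫ x, f₂ x‖ ≤
      A * C * (K * (1 + Module.finrank ℝ E)) * volume.real (Metric.ball (0 : E) 1) := by
    have hb : ‖τ • ∫ x, f₂ x‖ ≤
        A * K * (1 + Module.finrank ℝ E) * τ * C * volume.real (Metric.ball (0 : E) 1) := by
      rw [← hleft, hibp, norm_neg]
      refine norm_integral_le_of_eq_zero_off_ball (fun x hx => ?_) fun x hx => ?_
      · have : fderiv ℝ V x = 0 := by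
          by_contra h
          exact hx (hVsupp (support_fderiv_subset ℝ h))
        simp [this]
      · rw [norm_smul, Real.norm_eq_abs]
        gcongr
        · exact abs_trace_fderiv_smul_apply_le hJ hφ hτ hτr hJsq hJK hφA hφA' hφJ hx
        · exact hGC _ (hmem x hx)
    rw [norm_smul, Real.norm_of_nonneg hτ.le] at hb
    refine le_of_mul_le_mul_left (hb.trans (le_of_eq ?_)) hτ
    ring
  rw [hsplit]
  calc _ ≤ ‖∫ x, f₁ x‖ + ‖∫ x, f₂ x‖ := by
        refine (norm_sub_le _ _).trans ?_
        simp
    _ ≤ _ := add_le_add hb₁ hb₂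
    _ = _ := by ring

/-- Pointwise values are approximated by means over balls of radius `r`, at a rate `O(r)` that
depends only on the bounds of `G` and `∂̄_J G`. -/
theorem norm_integral_smul_sub_le {J : E → E →L[ℝ] E} {φ : E → ℝ} {G : E → ℂ} {a : E}
    {A C K r : ℝ}
    (hG : ContDiff ℝ 1 G) (hJ : ContDiff ℝ 1 J) (hφ : ContDiff ℝ 1 φ) (hr : 0 < r)
    (hJsq : ∀ x ∈ Metric.ball a r, ∀ v, J x (J x v) = -v)
    (hJK : ∀ x ∈ Metric.ball a r, ‖fderiv ℝ J x‖ ≤ K)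
    (hGC : ∀ x ∈ Metric.ball a r, ‖G x‖ ≤ C)
    (hdG : ∀ x ∈ Metric.ball a r, ∀ v,
      ‖fderiv ℝ G x v + Complex.I * fderiv ℝ G x (J x v)‖ ≤ C * ‖v‖)
    (hφA : ∀ x, |φ x| ≤ A) (hφA' : ∀ x, ‖fderiv ℝ φ x‖ ≤ A)
    (hφs : tsupport φ ⊆ Metric.ball 0 1)
    (hφJ : ∀ x, fderiv ℝ φ x (J a x) = 0) :
    ‖(∫ x, φ x • G (a + r • x)) - (∫ x, φ x) • G a‖ ≤
      A * C * (1 + K * (1 + Module.finrank ℝ E)) * volume.real (Metric.ball (0 : E) 1) * r := by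
  have hφc : HasCompactSupport φ := by
    refine HasCompactSupport.of_support_subset_isCompact (isCompact_closedBall (0 : E) 1) ?_
    exact (subset_tsupport φ).trans (hφs.trans Metric.ball_subset_closedBall)
  have hG1 : Continuous (fderiv ℝ G) := hG.continuous_fderiv one_ne_zero
  have hφ0 := hφ.continuous
  have hG0 := hG.continuous
  have hi₁ : Integrable fun x => φ x • G (a + r • x) :=
    Continuous.integrable_of_hasCompactSupport (by fun_prop) hφc.smul_right
  have hi₂ : Integrable fun x => φ x • G a :=
    Continuous.integrable_of_hasCompactSupport (by fun_prop) hφc.smul_right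
  have hft : ∀ x, φ x • G (a + r • x) - φ x • G a =
      ∫ τ in (0 : ℝ)..r, φ x • fderiv ℝ G (a + τ • x) x := by
    intro x
    have hder : ∀ τ ∈ uIcc 0 r, HasDerivAt (fun τ : ℝ => φ x • G (a + τ • x))
        (φ x • fderiv ℝ G (a + τ • x) x) τ := by
      intro τ _
      have h1 : HasDerivAt (fun τ : ℝ => a + τ • x) x τ := by
        simpa using ((hasDerivAt_id τ).smul_const x).const_add a
      have h2 := (hG.differentiable one_ne_zero (a + τ • x)).hasFDerivAt.comp_hasDerivAt τ h1
      exact h2.const_smul (φ x)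
    have hcont : Continuous fun τ : ℝ => φ x • fderiv ℝ G (a + τ • x) x := by fun_prop
    rw [intervalIntegral.integral_eq_sub_of_hasDerivAt hder (hcont.intervalIntegrable _ _)]
    simp
  have hprod : Integrable (Function.uncurry fun (τ : ℝ) (x : E) => φ x • fderiv ℝ G (a + τ • x) x)
      ((volume.restrict (uIoc 0 r)).prod volume) := by
    have hcont : Continuous
        (Function.uncurry fun (τ : ℝ) (x : E) => φ x • fderiv ℝ G (a + τ • x) x) := by
      have h1 : Continuous fun q : ℝ × E => a + q.1 • q.2 := by fun_prop
      exact (hφ0.comp continuous_snd).smul ((hG1.comp h1).clm_apply continuous_snd)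
    have hcpt : IsCompact (Icc 0 r ×ˢ tsupport φ) := isCompact_Icc.prod hφc
    have h1 : IntegrableOn (Function.uncurry fun (τ : ℝ) (x : E) => φ x • fderiv ℝ G (a + τ • x) x)
        (Icc 0 r ×ˢ tsupport φ) (volume.prod volume) := hcont.continuousOn.integrableOn_compact hcpt
    have h2 : IntegrableOn (Function.uncurry fun (τ : ℝ) (x : E) => φ x • fderiv ℝ G (a + τ • x) x)
        (uIoc 0 r ×ˢ univ) (volume.prod volume) := by
      refine h1.of_forall_sdiff_eq_zero (measurableSet_uIoc.prod MeasurableSet.univ) ?_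
      rintro ⟨τ, x⟩ ⟨⟨hτ, -⟩, h⟩
      rw [uIoc_of_le hr.le] at hτ
      have : x ∉ tsupport φ := fun hx => h ⟨Ioc_subset_Icc_self hτ, hx⟩
      simp [Function.uncurry, image_eq_zero_of_notMem_tsupport this]
    rwa [IntegrableOn, ← Measure.prod_restrict, Measure.restrict_univ] at h2
  rw [← integral_smul_const, ← integral_sub hi₁ hi₂]
  simp_rw [hft]
  rw [← intervalIntegral_integral_swap hprod]
  have := intervalIntegral.norm_integral_le_of_norm_le_const (a := 0) (b := r)
    (f := fun τ => ∫ x, φ x • fderiv ℝ G (a + τ • x) x)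
    (C := A * C * (1 + K * (1 + Module.finrank ℝ E)) * volume.real (Metric.ball (0 : E) 1)) ?_
  · simpa [abs_of_pos hr] using this
  · intro τ hτ
    rw [uIoc_of_le hr.le] at hτ
    exact norm_integral_smul_fderiv_apply_le hG hJ hφ hτ.1 hτ.2 hJsq hJK hGC hdG hφA hφA' hφs hφJ

end

section
variable {E : Type*} [NormedAddCommGroup E] [InnerProductSpace ℝ E]

/-! ### Bump functions invariant under a complex structure -/

/-- A fixed smooth bump function on the real line, equal to `1` on `[-1/4, 1/4]` and supported in
`[-1/2, 1/2]`. -/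
noncomputable def lineBump : ContDiffBump (0 : ℝ) := ⟨1 / 4, 1 / 2, by norm_num, by norm_num⟩

/-- The bump function `ψ(‖x‖² + ‖T x‖²)` on `E`. When `T² = -1`, the quadratic form
`‖x‖² + ‖T x‖²` is `T`-invariant, and so is the bump function. -/
noncomputable def invariantBump (T : E →L[ℝ] E) (x : E) : ℝ := lineBump (‖x‖ ^ 2 + ‖T x‖ ^ 2)

theorem contDiff_invariantBump (T : E →L[ℝ] E) : ContDiff ℝ 1 (invariantBump T) := by
  have h : ContDiff ℝ 1 fun x : E => ‖x‖ ^ 2 + ‖T x‖ ^ 2 :=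
    (contDiff_norm_sq ℝ).add (T.contDiff.norm_sq ℝ)
  exact lineBump.contDiff.comp h

theorem tendsto_invariantBump {ι : Type*} {l : Filter ι} {S : ι → E →L[ℝ] E} {T : E →L[ℝ] E}
    {y : ι → E} {x : E} (hS : Tendsto S l (𝓝 T)) (hy : Tendsto y l (𝓝 x)) :
    Tendsto (fun i => invariantBump (S i) (y i)) l (𝓝 (invariantBump T x)) := by
  have hc : Continuous fun q : (E →L[ℝ] E) × E => q.1 q.2 := by fun_prop
  have hSy : Tendsto (fun i => S i (y i)) l (𝓝 (T x)) :=
    (hc.tendsto (T, x)).comp (hS.prodMk_nhds hy)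
  have h : Tendsto (fun i => ‖y i‖ ^ 2 + ‖S i (y i)‖ ^ 2) l (𝓝 (‖x‖ ^ 2 + ‖T x‖ ^ 2)) :=
    (hy.norm.pow 2).add (hSy.norm.pow 2)
  exact (lineBump.continuous.tendsto _).comp h

theorem invariantBump_nonneg (T : E →L[ℝ] E) (x : E) : 0 ≤ invariantBump T x := lineBump.nonneg

theorem invariantBump_le_one (T : E →L[ℝ] E) (x : E) : invariantBump T x ≤ 1 := lineBump.le_one

theorem abs_invariantBump_le_one (T : E →L[ℝ] E) (x : E) : |invariantBump T x| ≤ 1 := by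
  rw [abs_of_nonneg (invariantBump_nonneg T x)]
  exact invariantBump_le_one T x

theorem invariantBump_zero (T : E →L[ℝ] E) : invariantBump T 0 = 1 := by
  refine lineBump.one_of_mem_closedBall ?_
  simp [lineBump]

theorem tsupport_invariantBump_subset (T : E →L[ℝ] E) :
    tsupport (invariantBump T) ⊆ Metric.ball 0 1 := by
  have hcl : IsClosed {x : E | ‖x‖ ^ 2 + ‖T x‖ ^ 2 ≤ 1 / 2} :=
    isClosed_le (by fun_prop) continuous_const
  have hsub : Function.support (invariantBump T) ⊆ {x : E | ‖x‖ ^ 2 + ‖T x‖ ^ 2 ≤ 1 / 2} := by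
    intro x hx
    have h1 : ‖x‖ ^ 2 + ‖T x‖ ^ 2 ∈ Function.support lineBump := hx
    rw [lineBump.support_eq, Metric.mem_ball, Real.dist_eq, sub_zero] at h1
    exact (le_abs_self _).trans h1.le
  refine (closure_minimal hsub hcl).trans fun x hx => ?_
  have hx' : ‖x‖ ^ 2 + ‖T x‖ ^ 2 ≤ 1 / 2 := hx
  rw [mem_ball_zero_iff]
  nlinarith [sq_nonneg ‖T x‖, norm_nonneg x]

theorem invariantBump_eq_zero (T : E →L[ℝ] E) {x : E} (hx : x ∉ Metric.ball (0 : E) 1) :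
    invariantBump T x = 0 :=
  image_eq_zero_of_notMem_tsupport fun h => hx (tsupport_invariantBump_subset T h)

theorem fderiv_invariantBump_apply (T : E →L[ℝ] E) (x v : E) :
    fderiv ℝ (invariantBump T) x v =
      deriv lineBump (‖x‖ ^ 2 + ‖T x‖ ^ 2) * (2 * inner ℝ x v + 2 * inner ℝ (T x) (T v)) := by
  have h1 : HasFDerivAt (fun x : E => ‖x‖ ^ 2) _ x := (hasFDerivAt_id x).norm_sq
  have h2 : HasFDerivAt (fun x : E => ‖T x‖ ^ 2) _ x := (T.hasFDerivAt (x := x)).norm_sq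
  have h3 : HasDerivAt lineBump (deriv lineBump (‖x‖ ^ 2 + ‖T x‖ ^ 2)) (‖x‖ ^ 2 + ‖T x‖ ^ 2) :=
    ((lineBump.contDiff (n := 1)).differentiable one_ne_zero _).hasDerivAt
  have h4 : fderiv ℝ (invariantBump T) x = _ := (h3.comp_hasFDerivAt x (h1.add h2)).fderiv
  rw [h4]
  simp
  ring

theorem fderiv_invariantBump_apply_self {T : E →L[ℝ] E} (hT : ∀ v, T (T v) = -v) (x : E) :
    fderiv ℝ (invariantBump T) x (T x) = 0 := by
  rw [fderiv_invariantBump_apply, hT, inner_neg_right, real_inner_comm]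
  ring

theorem exists_norm_fderiv_invariantBump_le (κ : ℝ) :
    ∃ A, ∀ T : E →L[ℝ] E, ‖T‖ ≤ κ → ∀ x, ‖fderiv ℝ (invariantBump T) x‖ ≤ A := by
  obtain ⟨B, hB⟩ := (lineBump.hasCompactSupport.deriv (f := lineBump)).exists_bound_of_continuous
    ((lineBump.contDiff (n := 1)).continuous_deriv le_rfl)
  have hB0 : 0 ≤ B := (norm_nonneg _).trans (hB 0)
  refine ⟨B * (2 + 2 * κ ^ 2), fun T hT x => ?_⟩
  have hκ : 0 ≤ κ := (norm_nonneg T).trans hT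
  by_cases hx : x ∈ Metric.ball (0 : E) 1
  · have hx1 : ‖x‖ ≤ 1 := (mem_ball_zero_iff.1 hx).le
    refine ContinuousLinearMap.opNorm_le_bound _ (by positivity) fun v => ?_
    rw [fderiv_invariantBump_apply, norm_mul]
    have e1 : |inner ℝ x v| ≤ ‖v‖ := (abs_real_inner_le_norm x v).trans (by
      nlinarith [norm_nonneg v])
    have e2 : |inner ℝ (T x) (T v)| ≤ κ ^ 2 * ‖v‖ := by
      refine (abs_real_inner_le_norm _ _).trans ?_
      calc ‖T x‖ * ‖T v‖ ≤ (κ * 1) * (κ * ‖v‖) := by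
            gcongr
            · exact (T.le_opNorm x).trans (by gcongr)
            · exact (T.le_opNorm v).trans (by gcongr)
        _ = _ := by ring
    have e3 : ‖2 * inner ℝ x v + 2 * inner ℝ (T x) (T v)‖ ≤ (2 + 2 * κ ^ 2) * ‖v‖ := by
      rw [Real.norm_eq_abs, abs_le]
      rw [abs_le] at e1 e2
      constructor <;> linarith [e1.1, e1.2, e2.1, e2.2]
    calc _ ≤ B * ((2 + 2 * κ ^ 2) * ‖v‖) := mul_le_mul (hB _) e3 (norm_nonneg _) hB0
      _ = _ := by ring
  · have : fderiv ℝ (invariantBump T) x = 0 := by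
      by_contra h
      exact hx (tsupport_invariantBump_subset T (support_fderiv_subset ℝ h))
    rw [this, norm_zero]
    positivity

variable [FiniteDimensional ℝ E]

theorem hasCompactSupport_invariantBump (T : E →L[ℝ] E) : HasCompactSupport (invariantBump T) :=
  HasCompactSupport.of_support_subset_isCompact (isCompact_closedBall (0 : E) 1)
    ((subset_tsupport _).trans
      ((tsupport_invariantBump_subset T).trans Metric.ball_subset_closedBall))

/-- A function of class `C¹` on a ball agrees on a smaller ball with a globally `C¹` function. -/
theorem exists_contDiff_eqOn_ball {F : Type*} [NormedAddCommGroup F] [NormedSpace ℝ F] {f : E → F}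
    {a : E} {r R : ℝ} (hr : 0 < r) (hrR : r < R) (hf : ContDiffOn ℝ 1 f (Metric.ball a R)) :
    ∃ g : E → F, ContDiff ℝ 1 g ∧ EqOn g f (Metric.ball a r) := by
  let χ : ContDiffBump a := ⟨r, (r + R) / 2, hr, by linarith⟩
  refine ⟨fun x => χ x • f x, contDiff_iff_contDiffAt.2 fun x => ?_, fun x hx => ?_⟩
  · by_cases hx : x ∈ Metric.ball a R
    · exact χ.contDiff.contDiffAt.smul (hf.contDiffAt (Metric.isOpen_ball.mem_nhds hx))
    · have hx' : x ∉ tsupport χ := by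
        rw [χ.tsupport_eq, Metric.mem_closedBall, not_le]
        have : R ≤ dist x a := by simpa using hx
        exact lt_of_lt_of_le (by change (r + R) / 2 < R; linarith) this
      have h0 := notMem_tsupport_iff_eventuallyEq.1 hx'
      refine (contDiffAt_const (c := (0 : F))).congr_of_eventuallyEq ?_
      filter_upwards [h0] with y hy
      rw [hy]; simp
  · have : χ x = 1 := χ.one_of_mem_closedBall (Metric.ball_subset_closedBall hx)
    simp [this]

variable [MeasurableSpace E] [BorelSpace E]

theorem integral_invariantBump_pos (T : E →L[ℝ] E) : 0 < ∫ x, invariantBump T x :=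
  (contDiff_invariantBump T).continuous.integral_pos_of_hasCompactSupport_nonneg_nonzero
    (hasCompactSupport_invariantBump T) (invariantBump_nonneg T) (x := 0)
    (by rw [invariantBump_zero]; exact one_ne_zero)

theorem tendsto_integral_invariantBump {ι : Type*} {l : Filter ι} [l.IsCountablyGenerated]
    {S : ι → E →L[ℝ] E} {T : E →L[ℝ] E} (hS : Tendsto S l (𝓝 T)) :
    Tendsto (fun i => ∫ x, invariantBump (S i) x) l (𝓝 (∫ x, invariantBump T x)) := by
  refine tendsto_integral_filter_of_dominated_convergence
    ((Metric.ball (0 : E) 1).indicator fun _ => (1 : ℝ)) ?_ ?_ ?_ ?_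
  · exact Eventually.of_forall fun i =>
      (contDiff_invariantBump _).continuous.aestronglyMeasurable
  · refine Eventually.of_forall fun i => Eventually.of_forall fun x => ?_
    by_cases hx : x ∈ Metric.ball (0 : E) 1
    · rw [indicator_of_mem hx]; exact abs_invariantBump_le_one _ _
    · rw [indicator_of_notMem hx, invariantBump_eq_zero _ hx, norm_zero]
  · exact (integrable_indicator_iff Metric.isOpen_ball.measurableSet).2
      (integrableOn_const measure_ball_lt_top.ne)
  · refine Eventually.of_forall fun x => ?_
    exact tendsto_invariantBump hS tendsto_const_nhds

/-- The kernels of the means centred at two nearby points are close in `L¹`. -/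
theorem tendsto_integral_abs_invariantBump_sub {ι : Type*} {l : Filter ι} [l.IsCountablyGenerated]
    {S S' : ι → E →L[ℝ] E} {T : E →L[ℝ] E} {η : ι → E} (hS : Tendsto S l (𝓝 T))
    (hS' : Tendsto S' l (𝓝 T)) (hη : Tendsto η l (𝓝 0)) :
    Tendsto (fun i => ∫ x, |invariantBump (S i) x - invariantBump (S' i) (x + η i)|) l (𝓝 0) := by
  have h0 : (0 : ℝ) = ∫ _x : E, (0 : ℝ) := by simp
  rw [h0]
  refine tendsto_integral_filter_of_dominated_convergence
    ((Metric.ball (0 : E) 2).indicator fun _ => (2 : ℝ)) ?_ ?_ ?_ ?_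
  · refine Eventually.of_forall fun i => Continuous.aestronglyMeasurable ?_
    have h1 := (contDiff_invariantBump (S i)).continuous
    have h2 := (contDiff_invariantBump (S' i)).continuous
    fun_prop
  · have hη1 : ∀ᶠ i in l, ‖η i‖ < 1 := by
      have := hη.norm
      rw [norm_zero] at this
      exact this.eventually_lt_const one_pos
    filter_upwards [hη1] with i hi
    refine Eventually.of_forall fun x => ?_
    rw [Real.norm_eq_abs, abs_abs]
    by_cases hx : x ∈ Metric.ball (0 : E) 2
    · rw [indicator_of_mem hx]
      have e1 := abs_invariantBump_le_one (S i) x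
      have e2 := abs_invariantBump_le_one (S' i) (x + η i)
      refine (abs_sub _ _).trans ?_
      linarith
    · have hx2 : 2 ≤ ‖x‖ := by simpa using hx
      have h1 : x ∉ Metric.ball (0 : E) 1 := by
        rw [mem_ball_zero_iff]; linarith
      have h2 : x + η i ∉ Metric.ball (0 : E) 1 := by
        rw [mem_ball_zero_iff]
        have := norm_sub_le (x + η i) (η i)
        rw [add_sub_cancel_right] at this
        linarith
      rw [indicator_of_notMem hx, invariantBump_eq_zero _ h1, invariantBump_eq_zero _ h2]
      simp
  · exact (integrable_indicator_iff Metric.isOpen_ball.measurableSet).2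
      (integrableOn_const measure_ball_lt_top.ne)
  · refine Eventually.of_forall fun x => ?_
    have h1 : Tendsto (fun i => invariantBump (S i) x) l (𝓝 (invariantBump T x)) :=
      tendsto_invariantBump hS tendsto_const_nhds
    have h2 : Tendsto (fun i => invariantBump (S' i) (x + η i)) l (𝓝 (invariantBump T x)) :=
      tendsto_invariantBump hS' (by simpa using hη.const_add x)
    simpa using (h1.sub h2).abs

/-! ### Oscillation of functions with bounded `∂̄_J` -/

theorem integrable_invariantBump_smul {G : E → ℂ} {a : E} {r R : ℝ} (hr : 0 < r) (hrR : r < R)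
    (hG : ContDiffOn ℝ 1 G (Metric.ball a R)) (T : E →L[ℝ] E) :
    Integrable fun x => invariantBump T x • G (a + r • x) := by
  have hφ := (contDiff_invariantBump T).continuous
  obtain ⟨G', hG', heq⟩ := exists_contDiff_eqOn_ball hr hrR hG
  have hG0 := hG'.continuous
  have : Integrable fun x => invariantBump T x • G' (a + r • x) :=
    Continuous.integrable_of_hasCompactSupport (by fun_prop)
      (hasCompactSupport_invariantBump T).smul_right
  refine this.congr (Eventually.of_forall fun x => ?_)
  by_cases hx : x ∈ Metric.ball (0 : E) 1
  · have : a + r • x ∈ Metric.ball a r := by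
      have hx1 : ‖x‖ < 1 := by simpa using hx
      rw [Metric.mem_ball, dist_eq_norm, add_sub_cancel_left, norm_smul, Real.norm_of_nonneg hr.le]
      nlinarith
    simp only [heq this]
  · simp [invariantBump_eq_zero T hx]

/-- Local form of the mollification estimate, with constants uniform for `a` near a given point. -/
theorem exists_norm_integral_invariantBump_smul_sub_le {J : E → E →L[ℝ] E} {x₀ : E} (C : ℝ)
    (hJ : ContDiffAt ℝ 1 J x₀) (hJsq : ∀ᶠ x in 𝓝 x₀, ∀ v, J x (J x v) = -v) :
    ∃ M δ : ℝ, 0 < δ ∧ ∀ (G : E → ℂ) (a : E) (r R : ℝ), 0 < r → r < R →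
      Metric.ball a r ⊆ Metric.ball x₀ δ → ContDiffOn ℝ 1 G (Metric.ball a R) →
      (∀ x ∈ Metric.ball a R, ‖G x‖ ≤ C) →
      (∀ x ∈ Metric.ball a R, ∀ v,
        ‖fderiv ℝ G x v + Complex.I * fderiv ℝ G x (J x v)‖ ≤ C * ‖v‖) →
      ‖(∫ x, invariantBump (J a) x • G (a + r • x)) - (∫ x, invariantBump (J a) x) • G a‖ ≤
        M * r := by
  obtain ⟨u, hu, hJu⟩ := hJ.contDiffOn (m := 1) le_rfl (by simp)
  obtain ⟨δ₁, hδ₁, hδ₁u⟩ := Metric.mem_nhds_iff.1 (inter_mem hu hJsq)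
  obtain ⟨J', hJ', hJeq⟩ := exists_contDiff_eqOn_ball (half_pos hδ₁) (half_lt_self hδ₁)
    (hJu.mono fun x hx => (hδ₁u hx).1)
  have hdJ := hJ'.continuous_fderiv one_ne_zero
  have hb₁ : ∀ᶠ x in 𝓝 x₀, ‖J' x‖ < ‖J' x₀‖ + 1 :=
    hJ'.continuous.norm.continuousAt.eventually_lt continuousAt_const (lt_add_one _)
  have hb₂ : ∀ᶠ x in 𝓝 x₀, ‖fderiv ℝ J' x‖ < ‖fderiv ℝ J' x₀‖ + 1 :=
    hdJ.norm.continuousAt.eventually_lt continuousAt_const (lt_add_one _)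
  obtain ⟨δ₂, hδ₂, hδ₂b⟩ := Metric.mem_nhds_iff.1 (hb₁.and hb₂)
  obtain ⟨A₀, hA₀⟩ := exists_norm_fderiv_invariantBump_le (E := E) (‖J' x₀‖ + 1)
  set A := max A₀ 1
  set K := ‖fderiv ℝ J' x₀‖ + 1
  refine ⟨A * C * (1 + K * (1 + Module.finrank ℝ E)) * volume.real (Metric.ball (0 : E) 1),
    min (δ₁ / 2) δ₂, lt_min (half_pos hδ₁) hδ₂, ?_⟩
  intro G a r R hr hrR hball hG hGC hdG
  have hsub₁ : Metric.ball a r ⊆ Metric.ball x₀ (δ₁ / 2) :=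
    hball.trans (Metric.ball_subset_ball (min_le_left _ _))
  have hsub₂ : Metric.ball a r ⊆ Metric.ball x₀ δ₂ :=
    hball.trans (Metric.ball_subset_ball (min_le_right _ _))
  have hsubR : Metric.ball a r ⊆ Metric.ball a R := Metric.ball_subset_ball hrR.le
  have haa : a ∈ Metric.ball a r := Metric.mem_ball_self hr
  have hJa : J' a = J a := hJeq (hsub₁ haa)
  have hsq : ∀ x ∈ Metric.ball a r, ∀ v, J' x (J' x v) = -v := by
    intro x hx v
    rw [hJeq (hsub₁ hx)]
    exact (hδ₁u (Metric.ball_subset_ball (half_le_self hδ₁.le) (hsub₁ hx))).2 v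
  obtain ⟨G', hG', hGeq⟩ := exists_contDiff_eqOn_ball hr hrR hG
  have hdGeq : ∀ x ∈ Metric.ball a r, fderiv ℝ G' x = fderiv ℝ G x := fun x hx =>
    (hGeq.eventuallyEq_of_mem (Metric.isOpen_ball.mem_nhds hx)).fderiv_eq
  have key := norm_integral_smul_sub_le (J := J') (φ := invariantBump (J' a)) (G := G') (a := a)
    (A := A) (C := C) (K := K) hG' hJ' (contDiff_invariantBump _) hr hsq
    (fun x hx => (hδ₂b (hsub₂ hx)).2.le)
    (fun x hx => by rw [hGeq hx]; exact hGC x (hsubR hx))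
    (fun x hx v => by
      rw [hdGeq x hx, hJeq (hsub₁ hx)]; exact hdG x (hsubR hx) v)
    (fun x => (abs_invariantBump_le_one _ x).trans (le_max_right _ _))
    (fun x => (hA₀ _ (hδ₂b (hsub₂ haa)).1.le x).trans (le_max_left _ _))
    (tsupport_invariantBump_subset _) (fderiv_invariantBump_apply_self (hsq a haa))
  rw [hJa, hGeq haa] at key
  have hmean : ∫ x, invariantBump (J a) x • G' (a + r • x) =
      ∫ x, invariantBump (J a) x • G (a + r • x) := ?_
  · rwa [hmean] at key
  refine integral_congr_ae (Eventually.of_forall fun x => ?_)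
  by_cases hx : x ∈ Metric.ball (0 : E) 1
  · have : a + r • x ∈ Metric.ball a r := by
      have hx1 : ‖x‖ < 1 := by simpa using hx
      rw [Metric.mem_ball, dist_eq_norm, add_sub_cancel_left, norm_smul, Real.norm_of_nonneg hr.le]
      nlinarith
    simp only [hGeq this]
  · simp [invariantBump_eq_zero (J a) hx]

/-- Let `G` be bounded with `∂̄_J G` bounded. If the points `a`, `b` are centres of balls of
radius `r → 0` in the domain of `G` and `a - b = o(r)`, then `G(a) - G(b) → 0`. -/
theorem tendsto_sub_of_dbar_bounded {ι : Type*} {l : Filter ι} [l.IsCountablyGenerated]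
    {J : E → E →L[ℝ] E} {G : E → ℂ} {U : Set E} {x₀ : E} {C : ℝ} {a b : ι → E} {r : ι → ℝ}
    (hJ : ContDiffAt ℝ 1 J x₀) (hJsq : ∀ᶠ x in 𝓝 x₀, ∀ v, J x (J x v) = -v)
    (hG : ContDiffOn ℝ 1 G U) (hGC : ∀ x ∈ U, ‖G x‖ ≤ C)
    (hdG : ∀ x ∈ U, ∀ v, ‖fderiv ℝ G x v + Complex.I * fderiv ℝ G x (J x v)‖ ≤ C * ‖v‖)
    (ha : Tendsto a l (𝓝 x₀)) (hb : Tendsto b l (𝓝 x₀)) (hr : Tendsto r l (𝓝 0))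
    (hr0 : ∀ᶠ i in l, 0 < r i) (haU : ∀ᶠ i in l, Metric.ball (a i) (r i) ⊆ U)
    (hbU : ∀ᶠ i in l, Metric.ball (b i) (r i) ⊆ U)
    (hab : Tendsto (fun i => (r i)⁻¹ • (a i - b i)) l (𝓝 0)) :
    Tendsto (fun i => G (a i) - G (b i)) l (𝓝 0) := by
  obtain ⟨M, δ, hδ, hM⟩ := exists_norm_integral_invariantBump_smul_sub_le C hJ hJsq
  have hJa : Tendsto (fun i => J (a i)) l (𝓝 (J x₀)) := hJ.continuousAt.tendsto.comp ha
  have hJb : Tendsto (fun i => J (b i)) l (𝓝 (J x₀)) := hJ.continuousAt.tendsto.comp hb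
  -- the means of `G` over balls of radius `r / 2`, and the normalizing constants
  set s : ι → ℝ := fun i => r i / 2 with hs
  set N : (ι → E) → ι → ℂ := fun a i =>
    ∫ x, invariantBump (J (a i)) x • G (a i + s i • x) with hN
  set c : (ι → E) → ι → ℝ := fun a i => ∫ x, invariantBump (J (a i)) x with hc
  set c₀ : ℝ := ∫ x, invariantBump (J x₀) x with hc₀
  have hc₀pos : 0 < c₀ := integral_invariantBump_pos _
  have hca : Tendsto (c a) l (𝓝 c₀) := tendsto_integral_invariantBump hJa
  have hcb : Tendsto (c b) l (𝓝 c₀) := tendsto_integral_invariantBump hJb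
  have hs0 : Tendsto s l (𝓝 0) := by simpa using hr.div_const 2
  have happrox : ∀ a : ι → E, Tendsto a l (𝓝 x₀) → (∀ᶠ i in l, Metric.ball (a i) (r i) ⊆ U) →
      Tendsto (fun i => N a i - c a i • G (a i)) l (𝓝 0) := by
    intro a ha haU
    have hsmall : ∀ᶠ i in l, Metric.ball (a i) (s i) ⊆ Metric.ball x₀ δ := by
      have h1 : Tendsto (fun i => s i + dist (a i) x₀) l (𝓝 0) := by
        simpa using hs0.add (tendsto_iff_dist_tendsto_zero.1 ha)
      filter_upwards [h1.eventually_lt_const hδ] with i hi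
      exact Metric.ball_subset_ball' hi.le
    refine squeeze_zero_norm' (a := fun i => M * s i) ?_ (by simpa using hs0.const_mul M)
    filter_upwards [hr0, haU, hsmall] with i hi hiU hiδ
    exact hM G (a i) (s i) (r i) (half_pos hi) (half_lt_self hi) hiδ (hG.mono hiU)
      (fun x hx => hGC x (hiU hx)) (fun x hx => hdG x (hiU hx))
  have hη : Tendsto (fun i => (s i)⁻¹ • (a i - b i)) l (𝓝 0) := by
    have := hab.const_smul (2 : ℝ)
    rw [smul_zero] at this
    refine this.congr fun i => ?_
    rw [smul_smul, hs, inv_div, div_eq_mul_inv]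
  have hNN : Tendsto (fun i => N a i - N b i) l (𝓝 0) := by
    have hI := (tendsto_integral_abs_invariantBump_sub hJa hJb hη).const_mul C
    rw [mul_zero] at hI
    refine squeeze_zero_norm' ?_ hI
    filter_upwards [hr0, haU, hbU] with i hi hiU hiU'
    have hsi : 0 < s i := half_pos hi
    set η := (s i)⁻¹ • (a i - b i)
    have hshift : ∀ x, b i + s i • (x + η) = a i + s i • x := by
      intro x
      simp only [η, smul_add, smul_smul, mul_inv_cancel₀ hsi.ne', one_smul]
      abel
    have hia := integrable_invariantBump_smul hsi (half_lt_self hi) (hG.mono hiU) (J (a i))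
    have hib := (integrable_invariantBump_smul hsi (half_lt_self hi) (hG.mono hiU')
      (J (b i))).comp_add_right η
    simp only [hshift] at hib
    have hNb : N b i = ∫ x, invariantBump (J (b i)) (x + η) • G (a i + s i • x) := by
      refine (integral_add_right_eq_self
        (fun x => invariantBump (J (b i)) x • G (b i + s i • x)) η).symm.trans ?_
      simp only [hshift]
    rw [hNb, hN, ← integral_sub hia hib, ← integral_const_mul]
    have hc1 := (contDiff_invariantBump (J (a i))).continuous
    have hc2 := (contDiff_invariantBump (J (b i))).continuous
    have hint : Integrable fun x => |invariantBump (J (a i)) x - invariantBump (J (b i)) (x + η)| :=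
      ((hc1.integrable_of_hasCompactSupport (hasCompactSupport_invariantBump _)).sub
        ((hc2.integrable_of_hasCompactSupport
          (hasCompactSupport_invariantBump _)).comp_add_right η)).abs
    refine norm_integral_le_of_norm_le (hint.const_mul C) (Eventually.of_forall fun x => ?_)
    rw [← sub_smul, norm_smul, Real.norm_eq_abs, mul_comm C]
    by_cases hx : invariantBump (J (a i)) x - invariantBump (J (b i)) (x + η) = 0
    · simp [hx]
    · -- one of the two bump functions does not vanish, so the point lies in the domain of `G`
      have hmem : a i + s i • x ∈ U := by
        have hin : ∀ (z : E) {T : E →L[ℝ] E} {y : E}, invariantBump T y ≠ 0 →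
            z + s i • y ∈ Metric.ball z (r i) := by
          intro z T y hy
          have hy1 : ‖y‖ < 1 := by
            by_contra h
            exact hy (invariantBump_eq_zero T (by simpa using h))
          rw [Metric.mem_ball, dist_eq_norm, add_sub_cancel_left, norm_smul,
            Real.norm_of_nonneg hsi.le]
          have : s i = r i / 2 := rfl
          nlinarith
        by_cases h1 : invariantBump (J (a i)) x = 0
        · rw [h1, zero_sub, neg_eq_zero] at hx
          rw [← hshift]
          exact hiU' (hin _ hx)
        · exact hiU (hin _ h1)
      gcongr
      exact hGC _ hmem
  have hcG : Tendsto (fun i => (c a i - c b i) • G (b i)) l (𝓝 0) := by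
    have h1 : Tendsto (fun i => |c a i - c b i| * C) l (𝓝 0) := by
      simpa using ((hca.sub hcb).abs).mul_const C
    refine squeeze_zero_norm' ?_ h1
    filter_upwards [hr0, hbU] with i hi hiU
    rw [norm_smul, Real.norm_eq_abs]
    gcongr
    exact hGC _ (hiU (Metric.mem_ball_self hi))
  have hmain : Tendsto (fun i => c a i • (G (a i) - G (b i))) l (𝓝 0) := by
    have := ((hNN.sub (happrox a ha haU)).add (happrox b hb hbU)).sub hcG
    simp only [sub_zero, add_zero] at this
    refine this.congr fun i => ?_
    simp only [sub_smul, smul_sub]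
    ring
  have hinv : Tendsto (fun i => (c a i)⁻¹ • (c a i • (G (a i) - G (b i)))) l (𝓝 0) := by
    simpa using (hca.inv₀ hc₀pos.ne').smul hmain
  refine hinv.congr' ?_
  filter_upwards with i
  rw [inv_smul_smul₀ (integral_invariantBump_pos _).ne']

end

/-! ### Curves with the same tangent in a wedge -/

section
variable {E : Type*} [NormedAddCommGroup E] [NormedSpace ℝ E]

/-- A function with `f(x₀) = 0` and `df(v) > 0` is negative on a truncated cone with vertex `x₀`
around the direction `-v`. -/
theorem HasFDerivAt.exists_forall_ball_neg {f : E → ℝ} {f' : E →L[ℝ] ℝ} {x₀ v : E}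
    (hf : HasFDerivAt f f' x₀) (h0 : f x₀ = 0) (hv : 0 < f' v) :
    ∃ ε > 0, ∀ᶠ s in 𝓝[>] (0 : ℝ), ∀ y ∈ Metric.ball (x₀ - s • v) (ε * s), f y < 0 := by
  set d := f' v
  set ε := min 1 (d / (4 * (‖f'‖ + 1)))
  have hε : 0 < ε := lt_min one_pos (by positivity)
  have hε1 : ε ≤ 1 := min_le_left _ _
  have hε2 : ‖f'‖ * ε ≤ d / 4 := by
    have h1 : ε ≤ d / (4 * (‖f'‖ + 1)) := min_le_right _ _
    rw [le_div_iff₀ (by positivity)] at h1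
    linarith
  set κ := d / (4 * (‖v‖ + 1))
  have hκ : 0 < κ := by positivity
  have hκ2 : κ * (‖v‖ + 1) = d / 4 := by
    simp only [κ]; field_simp
  obtain ⟨δ, hδ, hδf⟩ := Metric.eventually_nhds_iff.1 (hf.isLittleO.def hκ)
  refine ⟨ε, hε, ?_⟩
  have hsmall : ∀ᶠ s in 𝓝[>] (0 : ℝ), s * (‖v‖ + 1) < δ := by
    have : Tendsto (fun s : ℝ => s * (‖v‖ + 1)) (𝓝[>] 0) (𝓝 0) := by
      have h : Tendsto (fun s : ℝ => s * (‖v‖ + 1)) (𝓝 0) (𝓝 (0 * (‖v‖ + 1))) :=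
        (continuous_id.mul continuous_const).tendsto 0
      rw [zero_mul] at h
      exact h.mono_left nhdsWithin_le_nhds
    exact this.eventually_lt_const hδ
  filter_upwards [hsmall, self_mem_nhdsWithin] with s hs (hs0 : 0 < s) y hy
  have hw : ‖y - (x₀ - s • v)‖ < ε * s := by simpa [dist_eq_norm] using hy
  set w := y - (x₀ - s • v)
  have hyx : y - x₀ = w - s • v := by simp only [w]; abel
  have hn : ‖y - x₀‖ ≤ s * (‖v‖ + 1) := by
    rw [hyx]
    refine (norm_sub_le _ _).trans ?_
    rw [norm_smul, Real.norm_of_nonneg hs0.le]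
    nlinarith
  have h1 := hδf (y := y) (by rw [dist_eq_norm]; linarith)
  rw [h0, sub_zero, Real.norm_eq_abs] at h1
  have h2 : f' (y - x₀) ≤ ‖f'‖ * (ε * s) - s * d := by
    rw [hyx, map_sub, map_smul, smul_eq_mul]
    have := (le_abs_self _).trans (f'.le_opNorm w)
    have h3 : ‖f'‖ * ‖w‖ ≤ ‖f'‖ * (ε * s) := by gcongr
    linarith
  have h3 := (le_abs_self _).trans h1
  have h4 : κ * ‖y - x₀‖ ≤ d / 4 * s := by
    calc _ ≤ κ * (s * (‖v‖ + 1)) := by gcongr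
      _ = κ * (‖v‖ + 1) * s := by ring
      _ = _ := by rw [hκ2]
  nlinarith

/-- Along a curve asymptotic to `x₀ + c v` with `c < 0`, a function with `f(x₀) = 0` and
`df(v) > 0` is negative on balls of radius comparable to `|c|`. -/
theorem HasFDerivAt.exists_eventually_ball_neg {f : E → ℝ} {f' : E →L[ℝ] ℝ} {x₀ v : E}
    (hf : HasFDerivAt f f' x₀) (h0 : f x₀ = 0) (hv : 0 < f' v) :
    ∃ ε > 0, ∀ {l : Filter ℝ} {a : ℝ → E} {c : ℝ → ℝ}, Tendsto c l (𝓝 0) →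
      (fun t => a t - x₀ - c t • v) =o[l] c →
      ∀ᶠ t in l, c t < 0 → ∀ y ∈ Metric.ball (a t) (ε * |c t|), f y < 0 := by
  obtain ⟨ε, hε, h⟩ := hf.exists_forall_ball_neg h0 hv
  refine ⟨ε / 2, half_pos hε, fun {l a c} hc ha => ?_⟩
  have h' : ∀ᶠ s in 𝓝 (0 : ℝ), 0 < s → ∀ y ∈ Metric.ball (x₀ - s • v) (ε * s), f y < 0 :=
    eventually_nhdsWithin_iff.1 h
  have hc' : Tendsto (fun t => -c t) l (𝓝 0) := by simpa using hc.neg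
  filter_upwards [hc'.eventually h', ha.def (half_pos hε)] with t ht hat hct y hy
  refine ht (neg_pos.2 hct) y ?_
  rw [Real.norm_eq_abs, _root_.abs_of_neg hct] at hat
  rw [_root_.abs_of_neg hct] at hy
  refine Metric.ball_subset_ball' ?_ hy
  rw [dist_eq_norm, show a t - (x₀ - -c t • v) = a t - x₀ - c t • v by rw [neg_smul]; abel]
  linarith

theorem HasFDerivAt.eventually_pos_of_pos {f : E → ℝ} {f' : E →L[ℝ] ℝ} {x₀ v : E}
    (hf : HasFDerivAt f f' x₀) (h0 : f x₀ = 0) (hv : 0 < f' v) {l : Filter ℝ} {a : ℝ → E}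
    {c : ℝ → ℝ} (hc : Tendsto c l (𝓝 0)) (ha : (fun t => a t - x₀ - c t • v) =o[l] c) :
    ∀ᶠ t in l, 0 < c t → 0 < f (a t) := by
  obtain ⟨ε, hε, h⟩ := hf.neg.exists_eventually_ball_neg (v := -v) (by simp [h0]) (by simpa using hv)
  have hc' : Tendsto (fun t => -c t) l (𝓝 0) := by simpa using hc.neg
  have ha' : (fun t => a t - x₀ - (-c t) • -v) =o[l] fun t => -c t := by
    simpa using ha.neg_right
  filter_upwards [h hc' ha'] with t ht hct
  have := ht (neg_lt_zero.2 hct) (a t) (Metric.mem_ball_self (by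
    have : 0 < |-c t| := abs_pos.2 (by linarith)
    positivity))
  simpa using this

/-- The parameter of a tangent line is determined by the curve up to `o`: it tends to zero when the
curve tends to the base point. -/
theorem tendsto_zero_of_isLittleO_sub_smul {x₀ v : E} (hv : v ≠ 0) {l : Filter ℝ} {b : ℝ → E}
    {c : ℝ → ℝ} (hb : Tendsto b l (𝓝 x₀)) (hbc : (fun t => b t - x₀ - c t • v) =o[l] c) :
    Tendsto c l (𝓝 0) := by
  have hv0 : 0 < ‖v‖ := norm_pos_iff.2 hv
  have h1 : Tendsto (fun t => 2 / ‖v‖ * ‖b t - x₀‖) l (𝓝 0) := by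
    have := (tendsto_iff_norm_sub_tendsto_zero.1 hb).const_mul (2 / ‖v‖)
    rwa [mul_zero] at this
  refine squeeze_zero_norm' ?_ h1
  filter_upwards [hbc.def (half_pos hv0)] with t ht
  have h2 : ‖c t‖ * ‖v‖ ≤ ‖b t - x₀‖ + ‖v‖ / 2 * ‖c t‖ := by
    rw [← norm_smul]
    have := norm_sub_le (b t - x₀) (b t - x₀ - c t • v)
    rw [sub_sub_cancel] at this
    linarith
  rw [div_mul_eq_mul_div, le_div_iff₀ hv0]
  linarith

end

section
variable {E : Type*} [NormedAddCommGroup E] [InnerProductSpace ℝ E] [FiniteDimensional ℝ E]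
  [MeasurableSpace E] [BorelSpace E]

/-- The theorem in a linear chart: two curves in the wedge `{f_j < 0}` with the same transversal
tangent line at `x₀` give the same limit of a bounded function with bounded `∂̄_J`. -/
theorem tendsto_of_isLittleO_sub_smul {k : Type*} [Finite k] [Nonempty k]
    {J : E → E →L[ℝ] E} {G : E → ℂ} {U : Set E} {x₀ v : E} {C δ : ℝ}
    {f : k → E → ℝ} {f' : k → E →L[ℝ] ℝ} {α β : ℝ → E} {c : ℝ → ℝ} {L : ℂ}
    (hJ : ContDiffAt ℝ 1 J x₀) (hJsq : ∀ᶠ x in 𝓝 x₀, ∀ v, J x (J x v) = -v)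
    (hG : ContDiffOn ℝ 1 G U) (hGC : ∀ x ∈ U, ‖G x‖ ≤ C)
    (hdG : ∀ x ∈ U, ∀ v, ‖fderiv ℝ G x v + Complex.I * fderiv ℝ G x (J x v)‖ ≤ C * ‖v‖)
    (hδ : 0 < δ) (hU : ∀ x ∈ Metric.ball x₀ δ, (∀ j, f j x < 0) → x ∈ U)
    (hf : ∀ j, HasFDerivAt (f j) (f' j) x₀) (hf0 : ∀ j, f j x₀ = 0) (hfv : ∀ j, f' j v ≠ 0)
    (hα : HasDerivWithinAt α v (Iio 1) 1) (hα1 : α 1 = x₀)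
    (hαf : ∀ᶠ t in 𝓝[<] 1, ∀ j, f j (α t) < 0) (hαL : Tendsto (fun t => G (α t)) (𝓝[<] 1) (𝓝 L))
    (hβ : Tendsto β (𝓝[<] 1) (𝓝 x₀)) (hβf : ∀ᶠ t in 𝓝[<] 1, ∀ j, f j (β t) < 0)
    (hβc : (fun t => β t - x₀ - c t • v) =o[𝓝[<] 1] c) :
    Tendsto (fun t => G (β t)) (𝓝[<] 1) (𝓝 L) := by
  obtain ⟨j₀⟩ := (inferInstance : Nonempty k)
  have hv : v ≠ 0 := fun h => hfv j₀ (by rw [h, map_zero])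
  have hc : Tendsto c (𝓝[<] 1) (𝓝 0) := tendsto_zero_of_isLittleO_sub_smul hv hβ hβc
  have hαo : (fun t => α t - x₀ - (t - 1) • v) =o[𝓝[<] 1] fun t : ℝ => t - 1 := by
    have := hα.isLittleO
    rwa [hα1] at this
  have ht1 : Tendsto (fun t : ℝ => t - 1) (𝓝[<] 1) (𝓝 0) := by
    have h : Tendsto (fun t : ℝ => t - 1) (𝓝 1) (𝓝 (1 - 1)) :=
      (continuous_id.sub continuous_const).tendsto 1
    rw [sub_self] at h
    exact h.mono_left nhdsWithin_le_nhds
  -- the first curve enters the wedge from the side on which all `f j` increase along `v`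
  have hpos : ∀ j, 0 < f' j v := by
    intro j
    by_contra hneg
    have hneg' : 0 < (-f' j) v := by
      have := lt_of_le_of_ne (not_lt.1 hneg) (hfv j)
      simpa using this
    obtain ⟨ε, hε, h⟩ := (hf j).neg.exists_eventually_ball_neg (by simp [hf0]) hneg'
    obtain ⟨t, ⟨h1, h2⟩, h3⟩ :=
      (((h ht1 hαo).and hαf).and self_mem_nhdsWithin).exists
    have h3' : t - 1 < 0 := sub_neg.2 h3
    have h4 : -f j (α t) < 0 := h1 h3' (α t) (Metric.mem_ball_self (by
      have : 0 < |t - 1| := abs_pos.2 h3'.ne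
      positivity))
    linarith [h2 j]
  have hcneg : ∀ᶠ t in 𝓝[<] 1, c t < 0 := by
    filter_upwards [(hf j₀).eventually_pos_of_pos (hf0 j₀) (hpos j₀) hc hβc, hβf,
      hβc.def one_pos] with t h1 h2 h3
    by_contra hneg
    rcases (not_lt.1 hneg).eq_or_lt with h0 | h0
    · -- if `c t = 0` then `β t = x₀`, which is not in the wedge
      rw [← h0] at h3
      have : β t = x₀ := by simpa [sub_eq_zero] using h3
      have := h2 j₀
      simp_all
    · exact lt_asymm (h1 h0) (h2 j₀)
  -- the first curve, reparametrized so that it is asymptotic to the second one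
  have hu : Tendsto (fun t => 1 + c t) (𝓝[<] 1) (𝓝[<] 1) := by
    refine tendsto_nhdsWithin_iff.2 ⟨by simpa using hc.const_add 1, ?_⟩
    filter_upwards [hcneg] with t ht
    simpa using ht
  have hac : (fun t => α (1 + c t) - x₀ - c t • v) =o[𝓝[<] 1] c := by
    have := hαo.comp_tendsto hu
    simpa [Function.comp_def] using this
  have ha : Tendsto (fun t => α (1 + c t)) (𝓝[<] 1) (𝓝 x₀) := by
    have h1 := hα.continuousWithinAt.tendsto
    rw [hα1] at h1
    exact h1.comp hu
  -- balls of radius comparable to `|c|` around both curves stay in the wedge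
  choose ε hε hεf using fun j => (hf j).exists_eventually_ball_neg (hf0 j) (hpos j)
  obtain ⟨ε₀, hε₀, hε₀le⟩ : ∃ ε₀ > 0, ∀ j, ε₀ ≤ ε j := by
    obtain ⟨j, hj⟩ := Finite.exists_min ε
    exact ⟨ε j, hε j, hj⟩
  have hr : Tendsto (fun t => ε₀ * |c t|) (𝓝[<] 1) (𝓝 0) := by
    simpa using hc.abs.const_mul ε₀
  have hball : ∀ a : ℝ → E, Tendsto a (𝓝[<] 1) (𝓝 x₀) →
      (fun t => a t - x₀ - c t • v) =o[𝓝[<] 1] c →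
      ∀ᶠ t in 𝓝[<] 1, Metric.ball (a t) (ε₀ * |c t|) ⊆ U := by
    intro a ha hac
    have h1 : Tendsto (fun t => ε₀ * |c t| + dist (a t) x₀) (𝓝[<] 1) (𝓝 0) := by
      simpa using hr.add (tendsto_iff_dist_tendsto_zero.1 ha)
    filter_upwards [h1.eventually_lt_const hδ, hcneg,
      eventually_all.2 fun j => hεf j hc hac] with t h2 h3 h4 y hy
    refine hU y (Metric.ball_subset_ball' h2.le hy) fun j => h4 j h3 y ?_
    exact Metric.ball_subset_ball (by gcongr; exact hε₀le j) hy
  have hab : Tendsto (fun t => (ε₀ * |c t|)⁻¹ • (α (1 + c t) - β t)) (𝓝[<] 1) (𝓝 0) := by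
    have h1 : (fun t => α (1 + c t) - β t) =o[𝓝[<] 1] c := by
      have := hac.sub hβc
      simpa using this
    have h2 : (fun t => α (1 + c t) - β t) =o[𝓝[<] 1] fun t => ε₀ * |c t| :=
      (h1.abs_right).trans_isBigO ((isBigO_refl _ _).const_mul_right hε₀.ne')
    have h3 := h2.norm_left.tendsto_div_nhds_zero
    refine tendsto_zero_iff_norm_tendsto_zero.2 (h3.congr fun t => ?_)
    rw [norm_smul, norm_inv, Real.norm_of_nonneg (by positivity), div_eq_inv_mul]
  have key := tendsto_sub_of_dbar_bounded hJ hJsq hG hGC hdG ha hβ hr (by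
    filter_upwards [hcneg] with t ht
    have : 0 < |c t| := abs_pos.2 ht.ne
    positivity) (hball _ ha hac) (hball _ hβ hβc) hab
  have hLu : Tendsto (fun t => G (α (1 + c t))) (𝓝[<] 1) (𝓝 L) := hαL.comp hu
  simpa using hLu.sub key

end

/-! ### Passage to a chart -/

section
variable {m : ℕ} {M : Type*} [TopologicalSpace M]
  [ChartedSpace (EuclideanSpace ℝ (Fin m)) M] [IsManifold (𝓡 m) ∞ M]

/-- The coordinate frame at `q` of the chart at `p`: it sends a vector of the model space to the
tangent vector at `q` with these coordinates. -/
noncomputable def chartFrame (p q : M) : EuclideanSpace ℝ (Fin m) →L[ℝ] TangentSpace (𝓡 m) q :=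
  (trivializationAt (EuclideanSpace ℝ (Fin m)) (TangentSpace (𝓡 m)) p).symmL ℝ q

/-- The almost complex structure `J` read in the chart at `p`. -/
noncomputable def AlmostComplexStructure.inChart (𝒥 : AlmostComplexStructure m M) (p : M)
    (x : EuclideanSpace ℝ (Fin m)) : EuclideanSpace ℝ (Fin m) →L[ℝ] EuclideanSpace ℝ (Fin m) :=
  ContinuousLinearMap.inCoordinates (EuclideanSpace ℝ (Fin m)) (TangentSpace (𝓡 m))
    (EuclideanSpace ℝ (Fin m)) (TangentSpace (𝓡 m)) p ((extChartAt (𝓡 m) p).symm x) p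
    ((extChartAt (𝓡 m) p).symm x) (𝒥.J ((extChartAt (𝓡 m) p).symm x))

theorem mfderiv_extChartAt_chartFrame {p q : M}
    (hq : q ∈ (chartAt (EuclideanSpace ℝ (Fin m)) p).source) (v : EuclideanSpace ℝ (Fin m)) :
    mfderiv (𝓡 m) 𝓘(ℝ, EuclideanSpace ℝ (Fin m)) (extChartAt (𝓡 m) p) q (chartFrame p q v) = v := by
  rw [← TangentBundle.continuousLinearMapAt_trivializationAt hq]
  exact (trivializationAt (EuclideanSpace ℝ (Fin m)) (TangentSpace (𝓡 m)) p).continuousLinearMapAt_symmL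
    (R := ℝ) (by simpa using hq) v

theorem chartFrame_continuousLinearMapAt {p q : M}
    (hq : q ∈ (chartAt (EuclideanSpace ℝ (Fin m)) p).source) (w : TangentSpace (𝓡 m) q) :
    chartFrame p q ((trivializationAt (EuclideanSpace ℝ (Fin m)) (TangentSpace (𝓡 m))
      p).continuousLinearMapAt ℝ q w) = w :=
  (trivializationAt (EuclideanSpace ℝ (Fin m)) (TangentSpace (𝓡 m)) p).symmL_continuousLinearMapAt
    (R := ℝ) (by simpa using hq) w

theorem AlmostComplexStructure.chartFrame_inChart (𝒥 : AlmostComplexStructure m M) (p : M)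
    {x : EuclideanSpace ℝ (Fin m)} (hx : x ∈ (extChartAt (𝓡 m) p).target)
    (v : EuclideanSpace ℝ (Fin m)) :
    chartFrame p ((extChartAt (𝓡 m) p).symm x) (𝒥.inChart p x v) =
      𝒥.J _ (chartFrame p ((extChartAt (𝓡 m) p).symm x) v) := by
  have hq : (extChartAt (𝓡 m) p).symm x ∈ (chartAt (EuclideanSpace ℝ (Fin m)) p).source := by
    rw [← extChartAt_source (𝓡 m)]; exact (extChartAt (𝓡 m) p).map_target hx
  exact chartFrame_continuousLinearMapAt hq _

theorem AlmostComplexStructure.inChart_sq (𝒥 : AlmostComplexStructure m M) (p : M)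
    {x : EuclideanSpace ℝ (Fin m)} (hx : x ∈ (extChartAt (𝓡 m) p).target)
    (v : EuclideanSpace ℝ (Fin m)) : 𝒥.inChart p x (𝒥.inChart p x v) = -v := by
  have hq : (extChartAt (𝓡 m) p).symm x ∈ (chartAt (EuclideanSpace ℝ (Fin m)) p).source := by
    rw [← extChartAt_source (𝓡 m)]; exact (extChartAt (𝓡 m) p).map_target hx
  have h : chartFrame p ((extChartAt (𝓡 m) p).symm x) (𝒥.inChart p x (𝒥.inChart p x v)) =
      chartFrame p ((extChartAt (𝓡 m) p).symm x) (-v) := by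
    rw [𝒥.chartFrame_inChart p hx, 𝒥.chartFrame_inChart p hx, 𝒥.J_sq, map_neg]
  have h2 := mfderiv_extChartAt_chartFrame hq (𝒥.inChart p x (𝒥.inChart p x v))
  rw [h] at h2
  exact h2.symm.trans (mfderiv_extChartAt_chartFrame hq (-v))

theorem AlmostComplexStructure.contDiffAt_inChart (𝒥 : AlmostComplexStructure m M) (p : M) :
    ContDiffAt ℝ 1 (𝒥.inChart p) (extChartAt (𝓡 m) p p) := by
  have h1 := ((contMDiffAt_hom_bundle _).1 (𝒥.smooth p)).2
  have h2 : ContMDiffAt 𝓘(ℝ, EuclideanSpace ℝ (Fin m)) (𝓡 m) ∞ (extChartAt (𝓡 m) p).symm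
      (extChartAt (𝓡 m) p p) :=
    (contMDiffOn_extChartAt_symm p).contMDiffAt (extChartAt_target_mem_nhds p)
  have h3 := h1.comp_of_eq h2 (extChartAt_to_inv p)
  exact (contMDiffAt_iff_contDiffAt.1 h3).of_le (by simp)

/-- The differential of `u` in terms of that of its chart representation, at every point of the
chart and not only at its centre. -/
theorem mfderiv_eq_fderiv_comp_extChartAt_symm {F : Type*} [NormedAddCommGroup F]
    [NormedSpace ℝ F] {u : M → F} {p q : M}
    (hq : q ∈ (chartAt (EuclideanSpace ℝ (Fin m)) p).source)
    (hu : DifferentiableAt ℝ (u ∘ (extChartAt (𝓡 m) p).symm) (extChartAt (𝓡 m) p q))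
    (w : TangentSpace (𝓡 m) q) :
    mfderiv (𝓡 m) 𝓘(ℝ, F) u q w =
      fderiv ℝ (u ∘ (extChartAt (𝓡 m) p).symm) (extChartAt (𝓡 m) p q)
        (mfderiv (𝓡 m) 𝓘(ℝ, EuclideanSpace ℝ (Fin m)) (extChartAt (𝓡 m) p) q w) := by
  have h1 : HasMFDerivAt (𝓡 m) 𝓘(ℝ, EuclideanSpace ℝ (Fin m)) (extChartAt (𝓡 m) p) q
      (mfderiv (𝓡 m) 𝓘(ℝ, EuclideanSpace ℝ (Fin m)) (extChartAt (𝓡 m) p) q) :=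
    (mdifferentiableAt_extChartAt hq).hasMFDerivAt
  have h2 := hu.hasFDerivAt.hasMFDerivAt.comp q h1
  have heq : u =ᶠ[𝓝 q] (u ∘ (extChartAt (𝓡 m) p).symm) ∘ extChartAt (𝓡 m) p := by
    filter_upwards [(chartAt (EuclideanSpace ℝ (Fin m)) p).open_source.mem_nhds hq] with y hy
    have : (extChartAt (𝓡 m) p).symm (extChartAt (𝓡 m) p y) = y :=
      (extChartAt (𝓡 m) p).left_inv (by rwa [extChartAt_source])
    simp only [Function.comp_apply, this]
  rw [(h2.congr_of_eventuallyEq heq).mfderiv]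
  rfl

theorem ContinuousAt.exists_abs_apply_apply_le {X V : Type*} [TopologicalSpace X]
    [NormedAddCommGroup V] [NormedSpace ℝ V] {b : X → V →L[ℝ] V →L[ℝ] ℝ} {x : X}
    (hb : ContinuousAt b x) : ∃ B : ℝ, 0 ≤ B ∧ ∀ᶠ y in 𝓝 x, ∀ v, |b y v v| ≤ B * ‖v‖ ^ 2 := by
  -- supplied by hand, since the instance search for this iterated space is too long
  let _ : SeminormedAddGroup (V →L[ℝ] V →L[ℝ] ℝ) :=
    NormedAddCommGroup.toSeminormedAddCommGroup.toSeminormedAddGroup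
  refine ⟨‖b x‖ + 1, by positivity, ?_⟩
  filter_upwards [hb.norm.eventually_lt continuousAt_const (lt_add_one _)] with y hy v
  calc |b y v v| ≤ ‖b y‖ * ‖v‖ * ‖v‖ := (b y).le_opNorm₂ v v
    _ = ‖b y‖ * ‖v‖ ^ 2 := by ring
    _ ≤ _ := by gcongr

/-- Near `p` the metric is bounded by a multiple of the Euclidean metric of the chart. -/
theorem SmoothMetric.exists_inner_chartFrame_le (g : SmoothMetric m M) (p : M) :
    ∃ B : ℝ, 0 ≤ B ∧ ∀ᶠ q in 𝓝 p, ∀ v : EuclideanSpace ℝ (Fin m),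
      g.inner q (chartFrame p q v) (chartFrame p q v) ≤ B * ‖v‖ ^ 2 := by
  let g' : M → EuclideanSpace ℝ (Fin m) →L[ℝ] EuclideanSpace ℝ (Fin m) →L[ℝ] ℝ := fun q =>
    ContinuousLinearMap.inCoordinates (EuclideanSpace ℝ (Fin m)) (TangentSpace (𝓡 m))
      (EuclideanSpace ℝ (Fin m) →L[ℝ] ℝ) (fun q : M => TangentSpace (𝓡 m) q →L[ℝ] ℝ) p q p q
      (g.inner q)
  have h1 : ContinuousAt g' p := ((contMDiffAt_hom_bundle _).1 (g.contMDiff p)).2.continuousAt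
  obtain ⟨B, hB, hgB⟩ := h1.exists_abs_apply_apply_le
  refine ⟨B, hB, ?_⟩
  filter_upwards [hgB,
    (chartAt (EuclideanSpace ℝ (Fin m)) p).open_source.mem_nhds (mem_chart_source _ p)]
    with q hq hqs v
  have hqb : q ∈ (trivializationAt (EuclideanSpace ℝ (Fin m)) (TangentSpace (𝓡 m)) p).baseSet := by
    simpa using hqs
  have h2 := hq v
  simp only [g'] at h2
  rw [inCoordinates_apply_eq₂ hqb hqb (mem_univ _)] at h2
  refine (le_of_eq ?_).trans ((le_abs_self _).trans h2)
  have h4 : chartFrame p q v = (trivializationAt (EuclideanSpace ℝ (Fin m))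
      (TangentSpace (𝓡 m)) p).symm q v := by
    unfold chartFrame
    exact Trivialization.symmL_apply _ hqb v
  rw [h4]
  simp

end

theorem AlmostComplexStructure.two_mul_dbar_apply {m : ℕ} {M : Type*} [TopologicalSpace M]
    [ChartedSpace (EuclideanSpace ℝ (Fin m)) M] [IsManifold (𝓡 m) ∞ M]
    (𝒥 : AlmostComplexStructure m M) (F : M → ℂ) (q : M) (w : TangentSpace (𝓡 m) q) :
    2 * 𝒥.dbar F q w =
      complexDifferential m F q w + Complex.I * complexDifferential m F q (𝒥.J q w) := by
  have h : 𝒥.dbar F q w = (1 / 2 : ℂ) *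
    (complexDifferential m F q w + Complex.I * complexDifferential m F q (𝒥.J q w)) := rfl
  rw [h]
  ring

theorem isOpen_wedge {M : Type*} [TopologicalSpace M] {k : ℕ} {ρ : Fin k → M → ℝ}
    (hρ : ∀ j, Continuous (ρ j)) : IsOpen (wedge ρ) := by
  rw [show wedge ρ = ⋂ j, {p | ρ j p < 0} by ext; simp [wedge]]
  exact isOpen_iInter_of_finite fun j => isOpen_lt (hρ j) continuous_const

theorem proposition1 (n : ℕ) (hn : 1 < n) (M : Type*) [TopologicalSpace M] [T2Space M]
    [SecondCountableTopology M] [ChartedSpace (EuclideanSpace ℝ (Fin (2 * n))) M]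
    [IsManifold (𝓡 (2 * n)) ∞ M]
    (𝒥 : AlmostComplexStructure (2 * n) M)
    (g : SmoothMetric (2 * n) M) (hg : g.IsHermitian 𝒥)
    (ρ : Fin n → M → ℝ) (hρ : IsGenericDefiningFamily 𝒥 ρ)
    (F : M → ℂ) (hF : IsBoundedDbarSubsolution 𝒥 g (wedge ρ) F)
    (p : M) (γ₁ : ℝ → M) (hγ₁ : IsAdmissibleCurve (m := 2 * n) ρ p γ₁)
    (L : ℂ) (hL : Tendsto (fun t => F (γ₁ t)) (𝓝[<] 1) (𝓝 L))
    (γ₂ : ℝ → M) (hγ₂ : ContinuousOn γ₂ (Ico 0 1)) (hγ₂W : ∀ t ∈ Ico (0 : ℝ) 1, γ₂ t ∈ wedge ρ)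
    (hγ₂t : HasTangentLineAtEnd γ₂ (γ₁ 1) (endVelocity (2 * n) γ₁)) :
    Tendsto (fun t => F (γ₂ t)) (𝓝[<] 1) (𝓝 L) := by
  obtain rfl : γ₁ 1 = p := hγ₁.end_eq
  obtain ⟨hγ₂p, c, hc⟩ := hγ₂t
  obtain ⟨C₁, hC₁⟩ := hF.bounded
  obtain ⟨C₂, hC₂⟩ := hF.dbar_bounded
  obtain ⟨B, hB, hgB⟩ := SmoothMetric.exists_inner_chartFrame_le g (γ₁ 1)
  have : Nonempty (Fin n) := ⟨⟨0, by omega⟩⟩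
  set p := γ₁ 1
  set φ := extChartAt (𝓡 (2 * n)) p with hφ
  set x₀ := φ p
  set W := wedge ρ
  have hWo : IsOpen W := isOpen_wedge fun j => (hρ.smooth j).continuous
  have hsymm : ContMDiffOn 𝓘(ℝ, EuclideanSpace ℝ (Fin (2 * n))) (𝓡 (2 * n)) ∞ φ.symm φ.target :=
    contMDiffOn_extChartAt_symm p
  have hx₀ : φ.target ∈ 𝓝 x₀ := extChartAt_target_mem_nhds p
  have hinv : φ.symm x₀ = p := extChartAt_to_inv p
  have hcont : ContinuousAt φ.symm x₀ := continuousAt_extChartAt_symm p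
  obtain ⟨δ, hδ, hδball⟩ := Metric.mem_nhds_iff.1
    (inter_mem hx₀ (hcont.preimage_mem_nhds (by rw [hinv]; exact hgB)))
  set U := Metric.ball x₀ δ ∩ φ.symm ⁻¹' W with hU
  have hUt : U ⊆ φ.target := fun x hx => (hδball hx.1).1
  have hUo : IsOpen U :=
    (hsymm.continuousOn.mono fun x hx => (hδball hx).1).isOpen_inter_preimage Metric.isOpen_ball hWo
  have hsrc : ∀ x ∈ φ.target, φ.symm x ∈ (chartAt (EuclideanSpace ℝ (Fin (2 * n))) p).source := by
    intro x hx
    rw [← extChartAt_source (𝓡 (2 * n))]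
    exact φ.map_target hx
  have hG : ContDiffOn ℝ 1 (F ∘ φ.symm) U := by
    rw [← contMDiffOn_iff_contDiffOn]
    exact hF.contMDiffOn.comp ((hsymm.mono hUt).of_le (by simp)) fun x hx => hx.2
  have hdG : ∀ x ∈ U, ∀ v, ‖fderiv ℝ (F ∘ φ.symm) x v +
      Complex.I * fderiv ℝ (F ∘ φ.symm) x (𝒥.inChart p x v)‖ ≤
        max C₁ (2 * (|C₂| * √B)) * ‖v‖ := by
    intro x hx v
    have hq := hsrc x (hUt hx)
    have hxq : φ (φ.symm x) = x := φ.right_inv (hUt hx)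
    have hdiff : DifferentiableAt ℝ (F ∘ φ.symm) (φ (φ.symm x)) := by
      rw [hxq]
      exact (hG.contDiffAt (hUo.mem_nhds hx)).differentiableAt one_ne_zero
    have hframe : ∀ w, complexDifferential (2 * n) F (φ.symm x) (chartFrame p (φ.symm x) w) =
        fderiv ℝ (F ∘ φ.symm) x w := by
      intro w
      have h := mfderiv_eq_fderiv_comp_extChartAt_symm hq hdiff (chartFrame p (φ.symm x) w)
      rw [mfderiv_extChartAt_chartFrame hq, ← hφ, hxq] at h
      exact h
    rw [← hframe, ← hframe, 𝒥.chartFrame_inChart p (hUt hx), ← 𝒥.two_mul_dbar_apply]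
    have h1 := hC₂ (φ.symm x) hx.2 (chartFrame p (φ.symm x) v)
    have h2 : √(g.inner (φ.symm x) (chartFrame p (φ.symm x) v) (chartFrame p (φ.symm x) v)) ≤
        √B * ‖v‖ := by
      rw [← Real.sqrt_sq (norm_nonneg v), ← Real.sqrt_mul hB]
      exact Real.sqrt_le_sqrt ((hδball hx.1).2 v)
    calc _ ≤ 2 * (|C₂| * (√B * ‖v‖)) := by
          rw [norm_mul, Complex.norm_two]
          gcongr
          exact h1.trans (mul_le_mul (le_abs_self _) h2 (Real.sqrt_nonneg _) (abs_nonneg _))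
      _ = 2 * (|C₂| * √B) * ‖v‖ := by ring
      _ ≤ _ := by gcongr; exact le_max_right _ _
  have hρd : ∀ j, DifferentiableAt ℝ (ρ j ∘ φ.symm) x₀ := by
    intro j
    have h1 : ContMDiffAt 𝓘(ℝ, EuclideanSpace ℝ (Fin (2 * n))) 𝓘(ℝ, ℝ) ∞ (ρ j ∘ φ.symm) x₀ :=
      (hρ.smooth j).contMDiffAt.comp x₀ (hsymm.contMDiffAt hx₀)
    exact (contMDiffAt_iff_contDiffAt.1 h1).differentiableAt (by simp)
  set v : EuclideanSpace ℝ (Fin (2 * n)) :=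
    mfderiv (𝓡 (2 * n)) 𝓘(ℝ, EuclideanSpace ℝ (Fin (2 * n))) φ p (endVelocity (2 * n) γ₁)
  have hIio : ∀ᶠ t in 𝓝[<] (1 : ℝ), t ∈ Ico (0 : ℝ) 1 := Ico_mem_nhdsLT one_pos
  have hα : HasDerivWithinAt (φ ∘ γ₁) v (Iio 1) 1 := by
    have h1 : MDifferentiableWithinAt 𝓘(ℝ, ℝ) (𝓡 (2 * n)) γ₁ (Icc 0 1) 1 :=
      (hγ₁.smooth 1 (right_mem_Icc.2 zero_le_one)).mdifferentiableWithinAt (by simp)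
    have h2 : MDifferentiableAt (𝓡 (2 * n)) 𝓘(ℝ, EuclideanSpace ℝ (Fin (2 * n))) φ (γ₁ 1) :=
      mdifferentiableAt_extChartAt (mem_chart_source _ _)
    let A : ℝ →L[ℝ] EuclideanSpace ℝ (Fin (2 * n)) :=
      (mfderiv (𝓡 (2 * n)) 𝓘(ℝ, EuclideanSpace ℝ (Fin (2 * n))) φ (γ₁ 1)).comp
        (mfderivWithin 𝓘(ℝ, ℝ) (𝓡 (2 * n)) γ₁ (Icc 0 1) 1)
    have h3 : HasFDerivWithinAt (φ ∘ γ₁) A (Icc 0 1) 1 :=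
      (h2.hasMFDerivAt.comp_hasMFDerivWithinAt 1 h1.hasMFDerivWithinAt).hasFDerivWithinAt
    have h4 : HasDerivWithinAt (φ ∘ γ₁) v (Icc 0 1) 1 := by
      have h5 : HasDerivWithinAt (φ ∘ γ₁) (A 1) (Icc 0 1) 1 := h3.hasDerivWithinAt
      exact h5
    exact h4.mono_of_mem_nhdsWithin (mem_of_superset hIio Ico_subset_Icc_self)
  -- along a curve tending to `p` inside the wedge, `F` and the `ρ j` can be read in the chart
  have hback : ∀ γ : ℝ → M, Tendsto γ (𝓝[<] 1) (𝓝 p) →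
      ∀ᶠ t in 𝓝[<] 1, φ.symm (φ (γ t)) = γ t := fun γ hγ =>
    (hγ.eventually (extChartAt_source_mem_nhds (I := 𝓡 (2 * n)) p)).mono fun t ht => φ.left_inv ht
  have hγ₁p : Tendsto γ₁ (𝓝[<] 1) (𝓝 p) :=
    ((hγ₁.smooth.continuousOn 1 (right_mem_Icc.2 zero_le_one)).mono_of_mem_nhdsWithin
      (mem_of_superset hIio Ico_subset_Icc_self)).tendsto
  have hneg : ∀ γ : ℝ → M, Tendsto γ (𝓝[<] 1) (𝓝 p) → (∀ t ∈ Ico (0 : ℝ) 1, γ t ∈ W) →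
      ∀ᶠ t in 𝓝[<] 1, ∀ j, (ρ j ∘ φ.symm) (φ (γ t)) < 0 := by
    intro γ hγ hγW
    filter_upwards [hback γ hγ, hIio] with t h1 h2 j
    rw [Function.comp_apply, h1]
    exact hγW t h2 j
  have hmain := tendsto_of_isLittleO_sub_smul (k := Fin n) (J := 𝒥.inChart p) (G := F ∘ φ.symm)
    (U := U) (x₀ := x₀) (v := v) (f := fun j => ρ j ∘ φ.symm)
    (f' := fun j => fderiv ℝ (ρ j ∘ φ.symm) x₀) (α := φ ∘ γ₁) (β := φ ∘ γ₂) (c := c) (L := L)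
    (𝒥.contDiffAt_inChart p) (Filter.mem_of_superset hx₀ fun x hx v => 𝒥.inChart_sq p hx v) hG
    (fun x hx => (hC₁ _ hx.2).trans (le_max_left _ _)) hdG hδ (fun x hx h => ⟨hx, h⟩)
    (fun j => (hρd j).hasFDerivAt)
    (fun j => by rw [Function.comp_apply, hinv]; exact hγ₁.mem_edge j)
    (fun j => by
      rw [← mfderiv_eq_fderiv_comp_extChartAt_symm (mem_chart_source _ p) (hρd j)]
      exact hγ₁.not_tangent j)
    hα rfl (hneg γ₁ hγ₁p hγ₁.mem_wedge)
    (hL.congr' ((hback γ₁ hγ₁p).mono fun t ht => by simp only [Function.comp_apply, ht]))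
    ((continuousAt_extChartAt p).tendsto.comp hγ₂p) (hneg γ₂ hγ₂p hγ₂W) hc
  exact hmain.congr' ((hback γ₂ hγ₂p).mono fun t ht => by simp only [Function.comp_apply, ht])
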